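/- **Setting.** Let $n_s\ge 1$, $n_u,n_y\ge 0$ be integers, $T\ge 0$, $\Lambda\in\mathbb R^{n_s\times n_s}$, $B\in\mathbb R^{n_s\times n_u}$, $C\in\mathbb R^{n_y\times n_s}$, $L\ge 1$ and $\alpha>0$. Vectors carry the Euclidean norm and matrices the induced operator norm. Put $n_z=n_s+n_u+n_s$. Consider the linear-quadratic optimal control problem of minimizing $$\int_0^T\Big(\tfrac12\|Cs(t)\|^2+\tfrac12\|u(t)\|^2-q(t)^\top s(t)-r(t)^\top u(t)\Big)\,dt-\overline\lambda^\top s(T)$$ subject to $s(0)=\overline s$ and $\dot s=\Lambda s+Bu+d$ on $[0,T]$. For data $p=(q,r,d)\in L^2([0,T];\mathbb R^{n_z})$ and $\overline s,\overline\lambda\in\mathbb R^{n_s}$, a *mild solution* of its stationarity conditions is a $z=(s,u,\lambda)\in L^2([0,T];\mathbb R^{n_z})$ such that, for (almost) every $t\in[0,T]$, $$\lambda(t)=\int_t^T e^{\Lambda^\top(\tau-t)}\big(q(\tau)-C^\top C s(\tau)\big)\,d\tau+e^{\Lambda^\top(T-t)}\overline\lambda,$$ $$0=r(t)-u(t)+B^\top\lambda(t),\qquad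 s(t)=e^{\Lambda t}\overline s+\int_0^t e^{\Lambda(t-\tau)}\big(Bu(\tau)+d(\tau)\big)\,d\tau .$$ A square matrix $\Phi$ is *$(L,\alpha)$-stable* if $\|e^{\Phi t}\|\le Le^{-\alpha t}$ for all $t\ge 0$. **Assumptions.** 1. $\|\Lambda\|,\|B\|,\|C\|\le L$. 2. $(\Lambda,B)$ is $(L,\alpha)$-stabilizable: there is $K\in\mathbb R^{n_u\times n_s}$ with $\|K\|\le L$ such that $\Lambda-BK$ is $(L,\alpha)$-stable. 3. $(\Lambda,C)$ is $(L,\alpha)$-detectable: there is $K\in\mathbb R^{n_s\times n_y}$ with $\|K\|\le L$ such that $\Lambda-KC$ is $(L,\alpha)$-stable. 4. There is a bounded solution map $H^{-1}:L^2([0,T];\mathbb R^{n_z})\times\mathbb R^{n_s}\times\mathbb R^{n_s}\to L^2([0,T];\mathbb R^{n_z})$, that is, $H^{-1}(p,\overline s,\overline\lambda)$ is a mild solution for all data, and $\|H^{-1}(p,\overline s,\overline\lambda)\|_{L^2}\le M(\|p\|_{L^2}+\|\overline s\|+\|\overline\lambda\|)$ for all data with some constant $M$. **Theorem 4.3.**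 Under these assumptions, for all intervals $I_1,I_2\subseteq[0,T]$, all $p\in L^2([0,T];\mathbb R^{n_z})$ and all $\overline s,\overline\lambda\in\mathbb R^{n_s}$, the solution $z^\star=H^{-1}(p,\overline s,\overline\lambda)$ satisfies $$\left[\int_{I_1}\|z^\star(t)\|^2dt\right]^{1/2}\le 8\widetilde d\,\Bigg\{e^{-\frac{d(I_1,0)}{4\widetilde d}}\|\overline s\|+e^{-\frac{d(I_1,T)}{4\widetilde d}}\|\overline\lambda\|+e^{-\frac{d(I_1,I_2)}{4\widetilde d}}\left[\int_{I_2}\|p(t)\|^2dt\right]^{1/2}+e^{-\frac{d(I_1,[0,T]\setminus I_2)}{4\widetilde d}}\left[\int_{[0,T]\setminus I_2}\|p(t)\|^2dt\right]^{1/2}\Bigg\},$$ where $d(I,J)=\inf\{|x-y|:x\in I,\ y\in J\}$ (a distance involving an empty set may be given any finite value) and $$\widetilde d:=\frac{L(1+2L)\left(\alpha^2+L^4(1+L)^2\right)^{1/2}}{\alpha^2}+\frac{L^2(1+2L)^2}{\alpha^2}\max\left(1,\frac{L^2(1+L)^2}{(1+2L)^2}\right).$$ -/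

import Mathlib

open MeasureTheory Set
open scoped Matrix Matrix.Norms.L2Operator

noncomputable section

namespace LQControl

/-- `ℝⁿ` with its Euclidean norm. The norm of a matrix is the induced operator norm. -/
abbrev Vec (n : ℕ) : Type := EuclideanSpace ℝ (Fin n)

/-- The space `ℝ^{n_s} × ℝ^{n_u} × ℝ^{n_s}` with its Euclidean norm, in which both the solution
`z = (s, u, lam)` and the data `p = (q, r, d)` take their values. -/
abbrev Triple (ns nu : ℕ) : Type := WithLp 2 (Vec ns × WithLp 2 (Vec nu × Vec ns))

/-- The first component (`s` of the solution, `q` of the data). -/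
def comp₁ {ns nu : ℕ} (z : Triple ns nu) : Vec ns := z.fst

/-- The second component (`u` of the solution, `r` of the data). -/
def comp₂ {ns nu : ℕ} (z : Triple ns nu) : Vec nu := z.snd.fst

/-- The third component (`lam` of the solution, `d` of the data). -/
def comp₃ {ns nu : ℕ} (z : Triple ns nu) : Vec ns := z.snd.snd

/-- The Hilbert space `L²([0,T]; ℝ^{n_z})`, `n_z = n_s + n_u + n_s`. -/
abbrev L2Space (ns nu : ℕ) (T : ℝ) : Type :=
  Lp (Triple ns nu) 2 (volume.restrict (Icc (0 : ℝ) T))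

/-- `Φ` is `(L,α)`-stable: `‖e^{Φt}‖ ≤ L e^{-αt}` for all `t ≥ 0`. -/
def IsStable {n : ℕ} (L α : ℝ) (Φ : Matrix (Fin n) (Fin n) ℝ) : Prop :=
  ∀ t : ℝ, 0 ≤ t → ‖NormedSpace.exp (t • Φ)‖ ≤ L * Real.exp (-α * t)

/-- `(Λ,B)` is `(L,α)`-stabilizable. -/
def IsStabilizable {ns nu : ℕ} (L α : ℝ) (Λ : Matrix (Fin ns) (Fin ns) ℝ)
    (B : Matrix (Fin ns) (Fin nu) ℝ) : Prop :=
  ∃ K : Matrix (Fin nu) (Fin ns) ℝ, ‖K‖ ≤ L ∧ IsStable L α (Λ - B * K)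

/-- `(Λ,C)` is `(L,α)`-detectable. -/
def IsDetectable {ns ny : ℕ} (L α : ℝ) (Λ : Matrix (Fin ns) (Fin ns) ℝ)
    (C : Matrix (Fin ny) (Fin ns) ℝ) : Prop :=
  ∃ K : Matrix (Fin ns) (Fin ny) ℝ, ‖K‖ ≤ L ∧ IsStable L α (Λ - K * C)

/-- `z = (s, u, lam)` is a mild solution, on `[0,T]`, of the optimality system
`Cᵀ C s - lam' - Λᵀ lam = q`, `lam(T) = lbar`, `u - Bᵀ lam = r`, `s' - Λ s - B u = d`,
`s(0) = sbar`, with data `p = (q, r, d)`. As elements of `L²` are functions up to null sets, the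
equations are required for almost every `t ∈ [0,T]`. -/
def IsMildSolution {ns nu ny : ℕ} (Λ : Matrix (Fin ns) (Fin ns) ℝ)
    (B : Matrix (Fin ns) (Fin nu) ℝ) (C : Matrix (Fin ny) (Fin ns) ℝ) (T : ℝ)
    (p : ℝ → Triple ns nu) (sbar lbar : Vec ns) (z : ℝ → Triple ns nu) : Prop :=
  ∀ᵐ t ∂(volume.restrict (Icc (0 : ℝ) T)),
    comp₃ (z t) =
      (∫ τ in t..T, Matrix.toEuclideanLin (NormedSpace.exp ((τ - t) • Λᵀ))
        (comp₁ (p τ) - Matrix.toEuclideanLin (Cᵀ * C) (comp₁ (z τ))))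
      + Matrix.toEuclideanLin (NormedSpace.exp ((T - t) • Λᵀ)) lbar ∧
    0 = comp₂ (p t) - comp₂ (z t) + Matrix.toEuclideanLin Bᵀ (comp₃ (z t)) ∧
    comp₁ (z t) =
      Matrix.toEuclideanLin (NormedSpace.exp (t • Λ)) sbar
      + ∫ τ in (0 : ℝ)..t, Matrix.toEuclideanLin (NormedSpace.exp ((t - τ) • Λ))
        (Matrix.toEuclideanLin B (comp₂ (z τ)) + comp₃ (p τ))

/-- `Hinv` is a bounded solution map: it sends the data `(p, sbar, lbar)` to an `L²` mild solution
of the optimality system, with norm at most a constant times the norm of the data. -/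
structure IsBoundedSolutionMap {ns nu ny : ℕ} (Λ : Matrix (Fin ns) (Fin ns) ℝ)
    (B : Matrix (Fin ns) (Fin nu) ℝ) (C : Matrix (Fin ny) (Fin ns) ℝ) (T : ℝ)
    (Hinv : L2Space ns nu T → Vec ns → Vec ns → L2Space ns nu T) : Prop where
  bounded : ∃ M : ℝ, ∀ (p : L2Space ns nu T) (sbar lbar : Vec ns),
    ‖Hinv p sbar lbar‖ ≤ M * (‖p‖ + ‖sbar‖ + ‖lbar‖)
  mild : ∀ (p : L2Space ns nu T) (sbar lbar : Vec ns),
    IsMildSolution Λ B C T p sbar lbar (Hinv p sbar lbar)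

/-- The Euclidean distance `inf {|x - y| : x ∈ I, y ∈ J}` between two nonempty sets of reals. -/
def setDist (I J : Set ℝ) : ℝ := sInf {r : ℝ | ∃ x ∈ I, ∃ y ∈ J, r = |x - y|}

/-- The constant `d̃`. -/
def dTilde (L α : ℝ) : ℝ :=
  L * (1 + 2 * L) * Real.sqrt (α ^ 2 + L ^ 4 * (1 + L) ^ 2) / α ^ 2
    + L ^ 2 * (1 + 2 * L) ^ 2 / α ^ 2
      * max 1 (L ^ 2 * (1 + L) ^ 2 / (1 + 2 * L) ^ 2)

end LQControl

end

namespace LQControl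

theorem absolutelyContinuousOnInterval_of_dist_le {X : Type*} [PseudoMetricSpace X]
    {f : ℝ → X} {G : ℝ → ℝ} {a b : ℝ} (hG : AbsolutelyContinuousOnInterval G a b)
    (h : ∀ x ∈ uIcc a b, ∀ y ∈ uIcc a b, dist (f x) (f y) ≤ dist (G x) (G y)) :
    AbsolutelyContinuousOnInterval f a b := by
  unfold AbsolutelyContinuousOnInterval at hG ⊢
  refine squeeze_zero' (Filter.Eventually.of_forall
    fun _ => Finset.sum_nonneg fun _ _ => dist_nonneg) ?_ hG
  rw [Filter.eventually_inf_principal]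
  filter_upwards with E hE
  exact Finset.sum_le_sum fun i hi => h _ (hE.1 i hi).1 _ (hE.1 i hi).2

theorem absolutelyContinuousOnInterval_bilinear {E F G : Type*}
    [NormedAddCommGroup E] [NormedSpace ℝ E] [NormedAddCommGroup F] [NormedSpace ℝ F]
    [NormedAddCommGroup G] [NormedSpace ℝ G] (β : E →L[ℝ] F →L[ℝ] G)
    {f : ℝ → E} {g : ℝ → F} {a b : ℝ} (hf : AbsolutelyContinuousOnInterval f a b)
    (hg : AbsolutelyContinuousOnInterval g a b) :
    AbsolutelyContinuousOnInterval (fun t => β (f t) (g t)) a b := by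
  obtain ⟨M, hM⟩ := hf.exists_bound
  obtain ⟨N, hN⟩ := hg.exists_bound
  unfold AbsolutelyContinuousOnInterval at hf hg ⊢
  refine squeeze_zero' (Filter.Eventually.of_forall
    fun _ => Finset.sum_nonneg fun _ _ => dist_nonneg) ?_
    (by simpa using (hg.const_mul (‖β‖ * M)).add (hf.const_mul (‖β‖ * N)))
  rw [Filter.eventually_inf_principal]
  filter_upwards with E hE
  rw [Finset.mul_sum, Finset.mul_sum, ← Finset.sum_add_distrib]
  refine Finset.sum_le_sum fun i hi => ?_
  obtain ⟨h1, h2⟩ := hE.1 i hi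
  have key : β (f (E.2 i).1) (g (E.2 i).1) - β (f (E.2 i).2) (g (E.2 i).2) =
      β (f (E.2 i).1) (g (E.2 i).1 - g (E.2 i).2) + β (f (E.2 i).1 - f (E.2 i).2) (g (E.2 i).2) := by
    simp
  rw [dist_eq_norm, dist_eq_norm, dist_eq_norm, key]
  refine (norm_add_le _ _).trans (add_le_add ?_ ?_)
  · refine (β.le_opNorm₂ _ _).trans ?_
    gcongr
    exact hM _ h1
  · refine (β.le_opNorm₂ _ _).trans ?_
    rw [mul_assoc, mul_assoc, mul_comm N]
    gcongr
    exact hN _ h2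

/-- `f` is the integral of `g` on `[0,T]`, up to a constant. -/
structure HasIntegralDeriv {E : Type*} [NormedAddCommGroup E] [NormedSpace ℝ E]
    (f g : ℝ → E) (T : ℝ) : Prop where
  integrable : IntervalIntegrable g volume 0 T
  eq_add : ∀ t ∈ Icc 0 T, f t = f 0 + ∫ τ in (0 : ℝ)..t, g τ

namespace HasIntegralDeriv

variable {E F G : Type*} [NormedAddCommGroup E] [NormedSpace ℝ E]
  [NormedAddCommGroup F] [NormedSpace ℝ F] [NormedAddCommGroup G] [NormedSpace ℝ G]
  {f f₁ f₂ g g₁ g₂ : ℝ → E} {T : ℝ}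

theorem integrable_sub (h : HasIntegralDeriv f g T) {x y : ℝ} (hx : x ∈ Icc 0 T)
    (hy : y ∈ Icc 0 T) : IntervalIntegrable g volume x y := by
  have hT : (0 : ℝ) ≤ T := hx.1.trans hx.2
  refine h.integrable.mono_set ?_
  rw [uIcc_of_le hT]
  exact uIcc_subset_Icc hx hy

theorem sub_eq (h : HasIntegralDeriv f g T) {x y : ℝ} (hx : x ∈ Icc 0 T) (hy : y ∈ Icc 0 T) :
    f y - f x = ∫ τ in x..y, g τ := by
  have hT : (0 : ℝ) ≤ T := hx.1.trans hx.2
  rw [h.eq_add x hx, h.eq_add y hy, add_sub_add_left_eq_sub,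
    intervalIntegral.integral_interval_sub_left]
  · exact h.integrable_sub ⟨le_rfl, hT⟩ hy
  · exact h.integrable_sub ⟨le_rfl, hT⟩ hx

theorem absolutelyContinuous (h : HasIntegralDeriv f g T) (hT : 0 ≤ T) :
    AbsolutelyContinuousOnInterval f 0 T := by
  refine absolutelyContinuousOnInterval_of_dist_le
    (h.integrable.norm.absolutelyContinuousOnInterval_intervalIntegral (c := 0) (by simp)) ?_
  rw [uIcc_of_le hT]
  intro x hx y hy
  have h0 : (0 : ℝ) ∈ Icc 0 T := ⟨le_rfl, hT⟩
  rw [dist_comm, dist_eq_norm, h.sub_eq hx hy, dist_comm, Real.dist_eq,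
    intervalIntegral.integral_interval_sub_left (h.integrable_sub h0 hy).norm
      (h.integrable_sub h0 hx).norm]
  exact intervalIntegral.norm_integral_le_abs_integral_norm

theorem continuousOn (h : HasIntegralDeriv f g T) (hT : 0 ≤ T) : ContinuousOn f (Icc 0 T) := by
  simpa [uIcc_of_le hT] using (h.absolutelyContinuous hT).continuousOn

theorem ae_hasDerivAt [CompleteSpace E] (h : HasIntegralDeriv f g T) (hT : 0 ≤ T) :
    ∀ᵐ x, x ∈ Icc 0 T → HasDerivAt f (g x) x := by
  have h₁ : ∀ᵐ x : ℝ, x ≠ 0 := by simp [ae_iff, measure_singleton]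
  have h₂ : ∀ᵐ x : ℝ, x ≠ T := by simp [ae_iff, measure_singleton]
  filter_upwards [h.integrable.ae_hasDerivAt_integral, h₁, h₂] with x hx h1 h2 hxT
  rw [uIcc_of_le hT] at hx
  have := (hx hxT 0 ⟨le_rfl, hT⟩).const_add (f 0)
  refine this.congr_of_eventuallyEq ?_
  have : Ioo 0 T ∈ nhds x :=
    Ioo_mem_nhds (lt_of_le_of_ne hxT.1 (Ne.symm h1)) (lt_of_le_of_ne hxT.2 h2)
  filter_upwards [this] with y hy
  exact h.eq_add y (Ioo_subset_Icc_self hy)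

theorem of_ae_hasDerivAt [CompleteSpace E] (hT : 0 ≤ T)
    (hf : AbsolutelyContinuousOnInterval f 0 T)
    (hg : IntervalIntegrable g volume 0 T) (hd : ∀ᵐ x, x ∈ Icc 0 T → HasDerivAt f (g x) x) :
    HasIntegralDeriv f g T := by
  refine ⟨hg, ?_⟩
  let J : ℝ → E := fun t => ∫ τ in (0 : ℝ)..t, g τ
  have hJ : HasIntegralDeriv J g T := ⟨hg, fun t _ => by simp [J]⟩
  obtain ⟨c, hc⟩ := (hf.sub (hJ.absolutelyContinuous hT)).const_of_ae_hasDerivAt_zero (by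
    rw [uIcc_of_le hT]
    filter_upwards [hd, hJ.ae_hasDerivAt hT] with x h1 h2 hx
    simpa using (h1 hx).sub (h2 hx))
  rw [uIcc_of_le hT] at hc
  intro t ht
  have h1 := hc t ht
  have h2 := hc 0 ⟨le_rfl, hT⟩
  simp only [Pi.sub_apply, J, intervalIntegral.integral_same, sub_zero] at h1 h2
  rw [h2, ← h1]
  abel

theorem bilinear [CompleteSpace E] [CompleteSpace F] [CompleteSpace G] (β : E →L[ℝ] F →L[ℝ] G)
    {k l : ℝ → F} (hf : HasIntegralDeriv f g T) (hk : HasIntegralDeriv k l T) (hT : 0 ≤ T) :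
    HasIntegralDeriv (fun t => β (f t) (k t)) (fun t => β (f t) (l t) + β (g t) (k t)) T := by
  refine of_ae_hasDerivAt hT (absolutelyContinuousOnInterval_bilinear β
    (hf.absolutelyContinuous hT) (hk.absolutelyContinuous hT)) ?_ ?_
  · have cf := hf.continuousOn hT
    have ck := hk.continuousOn hT
    rw [intervalIntegrable_iff_integrableOn_Icc_of_le hT]
    have ig := (intervalIntegrable_iff_integrableOn_Icc_of_le hT).1 hf.integrable
    have il := (intervalIntegrable_iff_integrableOn_Icc_of_le hT).1 hk.integrable
    obtain ⟨M, hM⟩ := isCompact_Icc.exists_bound_of_continuousOn cf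
    obtain ⟨N, hN⟩ := isCompact_Icc.exists_bound_of_continuousOn ck
    have mf := cf.aestronglyMeasurable (μ := volume) measurableSet_Icc
    have mk := ck.aestronglyMeasurable (μ := volume) measurableSet_Icc
    refine Integrable.add ?_ ?_
    · refine (il.norm.const_mul (‖β‖ * M)).mono'
        (β.aestronglyMeasurable_comp₂ mf il.aestronglyMeasurable) ?_
      filter_upwards [ae_restrict_mem measurableSet_Icc] with t ht
      refine (β.le_opNorm₂ _ _).trans ?_
      gcongr
      exact hM t ht
    · refine (ig.norm.const_mul (‖β‖ * N)).mono'
        (β.aestronglyMeasurable_comp₂ ig.aestronglyMeasurable mk) ?_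
      filter_upwards [ae_restrict_mem measurableSet_Icc] with t ht
      refine (β.le_opNorm₂ _ _).trans ?_
      rw [mul_assoc, mul_assoc, mul_comm N]
      gcongr
      exact hN t ht
  · filter_upwards [hf.ae_hasDerivAt hT, hk.ae_hasDerivAt hT] with x h1 h2 hx
    exact β.hasDerivAt_of_bilinear (fun _ => h1 hx) (fun _ => h2 hx)

theorem congr (h : HasIntegralDeriv f g T) (hT : 0 ≤ T) (hf : ∀ t ∈ Icc 0 T, f₁ t = f t)
    (hg : ∀ᵐ t ∂(volume.restrict (Icc 0 T)), g₁ t = g t) : HasIntegralDeriv f₁ g₁ T := by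
  rw [ae_restrict_iff' measurableSet_Icc] at hg
  refine ⟨?_, ?_⟩
  · have := (intervalIntegrable_iff_integrableOn_Icc_of_le hT).1 h.integrable
    rw [intervalIntegrable_iff_integrableOn_Icc_of_le hT]
    refine Integrable.congr this ?_
    rw [Filter.EventuallyEq, ae_restrict_iff' measurableSet_Icc]
    filter_upwards [hg] with t ht h
    exact (ht h).symm
  · intro t ht
    rw [hf t ht, hf 0 ⟨le_rfl, hT⟩, h.eq_add t ht]
    congr 1
    refine intervalIntegral.integral_congr_ae ?_
    filter_upwards [hg] with x hx hxt
    rw [uIoc_of_le ht.1] at hxt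
    exact (hx ⟨hxt.1.le, hxt.2.trans ht.2⟩).symm

theorem add (h₁ : HasIntegralDeriv f₁ g₁ T) (h₂ : HasIntegralDeriv f₂ g₂ T) :
    HasIntegralDeriv (fun t => f₁ t + f₂ t) (fun t => g₁ t + g₂ t) T := by
  refine ⟨h₁.integrable.add h₂.integrable, fun t ht => ?_⟩
  have h0 : (0 : ℝ) ∈ Icc 0 T := ⟨le_rfl, ht.1.trans ht.2⟩
  rw [intervalIntegral.integral_add (h₁.integrable_sub h0 ht) (h₂.integrable_sub h0 ht),
    h₁.eq_add t ht, h₂.eq_add t ht]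
  abel

theorem neg (h : HasIntegralDeriv f g T) :
    HasIntegralDeriv (fun t => - f t) (fun t => - g t) T := by
  refine ⟨h.integrable.neg, fun t ht => ?_⟩
  rw [intervalIntegral.integral_neg, h.eq_add t ht, neg_add]

theorem sub (h₁ : HasIntegralDeriv f₁ g₁ T) (h₂ : HasIntegralDeriv f₂ g₂ T) :
    HasIntegralDeriv (fun t => f₁ t - f₂ t) (fun t => g₁ t - g₂ t) T := by
  simpa [sub_eq_add_neg] using h₁.add h₂.neg

theorem reflect (h : HasIntegralDeriv f g T) (hT : 0 ≤ T) :
    HasIntegralDeriv (fun t => f (T - t)) (fun t => - g (T - t)) T := by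
  refine ⟨?_, fun t ht => ?_⟩
  · have := (h.integrable.comp_sub_left T).symm
    rw [sub_self, sub_zero] at this
    exact this.neg
  · have h1 : T - t ∈ Icc 0 T := ⟨sub_nonneg.2 ht.2, sub_le_self _ ht.1⟩
    have h2 : T - 0 ∈ Icc 0 T := by simpa using hT
    rw [intervalIntegral.integral_neg, intervalIntegral.integral_comp_sub_left (fun x => g x),
      ← h.sub_eq h1 h2]
    abel

theorem of_hasDerivAt [CompleteSpace E] (hd : ∀ t, HasDerivAt f (g t) t)
    (hg : Continuous g) : HasIntegralDeriv f g T := by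
  refine ⟨hg.intervalIntegrable _ _, fun t _ => ?_⟩
  rw [intervalIntegral.integral_eq_sub_of_hasDerivAt (fun x _ => hd x)
    (hg.intervalIntegrable _ _)]
  abel

end HasIntegralDeriv

section L2Norm

variable {Ω E F : Type*} [MeasurableSpace Ω] {μ : Measure Ω} [NormedAddCommGroup E]
  [NormedAddCommGroup F]

/-- The `L²` norm of a function, as a real number. -/
noncomputable def l2norm (μ : Measure Ω) (f : Ω → E) : ℝ := (eLpNorm f 2 μ).toReal

theorem l2norm_nonneg (f : Ω → E) : 0 ≤ l2norm μ f := ENNReal.toReal_nonneg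

theorem l2norm_congr {f g : Ω → E} (h : f =ᵐ[μ] g) : l2norm μ f = l2norm μ g := by
  rw [l2norm, l2norm, eLpNorm_congr_ae h]

theorem l2norm_sq {f : Ω → E} (hf : MemLp f 2 μ) : l2norm μ f ^ 2 = ∫ x, ‖f x‖ ^ 2 ∂μ := by
  have h0 : 0 ≤ ∫ x, ‖f x‖ ^ 2 ∂μ := integral_nonneg fun x => by positivity
  rw [l2norm, hf.eLpNorm_eq_integral_rpow_norm (by norm_num) (by norm_num)]
  simp only [ENNReal.toReal_ofNat, Real.rpow_ofNat]
  rw [ENNReal.toReal_ofReal (by positivity), ← Real.rpow_natCast, ← Real.rpow_mul h0]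
  norm_num

theorem l2norm_add_le {f g : Ω → E} (hf : MemLp f 2 μ) (hg : MemLp g 2 μ) :
    l2norm μ (fun x => f x + g x) ≤ l2norm μ f + l2norm μ g := by
  rw [l2norm, l2norm, l2norm, ← ENNReal.toReal_add hf.eLpNorm_ne_top hg.eLpNorm_ne_top]
  exact ENNReal.toReal_mono (ENNReal.add_ne_top.2 ⟨hf.eLpNorm_ne_top, hg.eLpNorm_ne_top⟩)
    (eLpNorm_add_le hf.aestronglyMeasurable hg.aestronglyMeasurable (by norm_num))

theorem l2norm_neg (f : Ω → E) : l2norm μ (fun x => - f x) = l2norm μ f := by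
  rw [l2norm, l2norm, ← eLpNorm_neg f]; rfl

theorem l2norm_sub_le {f g : Ω → E} (hf : MemLp f 2 μ) (hg : MemLp g 2 μ) :
    l2norm μ (fun x => f x - g x) ≤ l2norm μ f + l2norm μ g := by
  have := l2norm_add_le hf hg.neg
  simp only [Pi.neg_apply, ← sub_eq_add_neg] at this
  rwa [show l2norm μ (-g) = l2norm μ g from l2norm_neg g] at this

theorem l2norm_le_mul {f : Ω → E} {g : Ω → F} {c : ℝ} (hc : 0 ≤ c) (hg : MemLp g 2 μ)
    (h : ∀ᵐ x ∂μ, ‖f x‖ ≤ c * ‖g x‖) : l2norm μ f ≤ c * l2norm μ g := by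
  have := eLpNorm_le_mul_eLpNorm_of_ae_le_mul h 2
  refine (ENNReal.toReal_mono (ENNReal.mul_ne_top ENNReal.ofReal_ne_top hg.eLpNorm_ne_top)
    this).trans ?_
  rw [ENNReal.toReal_mul, ENNReal.toReal_ofReal hc, l2norm]

theorem l2norm_mono {f : Ω → E} {g : Ω → F} (hg : MemLp g 2 μ)
    (h : ∀ᵐ x ∂μ, ‖f x‖ ≤ ‖g x‖) : l2norm μ f ≤ l2norm μ g := by
  simpa using l2norm_le_mul zero_le_one hg (by simpa using h)

theorem l2norm_clm_le [NormedSpace ℝ E] [NormedSpace ℝ F] (A : E →L[ℝ] F) {c : ℝ}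
    (hA : ‖A‖ ≤ c) {f : Ω → E} (hf : MemLp f 2 μ) :
    l2norm μ (fun x => A (f x)) ≤ c * l2norm μ f :=
  l2norm_le_mul ((norm_nonneg _).trans hA) hf
    (Filter.Eventually.of_forall fun _ => A.le_of_opNorm_le hA _)

theorem integrable_norm_mul_norm {f : Ω → E} {g : Ω → F} (hf : MemLp f 2 μ) (hg : MemLp g 2 μ) :
    Integrable (fun x => ‖f x‖ * ‖g x‖) μ :=
  hf.norm.integrable_mul hg.norm

theorem integral_norm_mul_norm_le {f : Ω → E} {g : Ω → F} (hf : MemLp f 2 μ)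
    (hg : MemLp g 2 μ) : ∫ x, ‖f x‖ * ‖g x‖ ∂μ ≤ l2norm μ f * l2norm μ g := by
  have key := integral_mul_le_Lp_mul_Lq_of_nonneg Real.HolderConjugate.two_two
    (μ := μ) (f := fun x => ‖f x‖) (g := fun x => ‖g x‖)
    (Filter.Eventually.of_forall fun _ => norm_nonneg _)
    (Filter.Eventually.of_forall fun _ => norm_nonneg _)
    (by simpa using hf.norm) (by simpa using hg.norm)
  refine key.trans (le_of_eq ?_)
  simp only [Real.rpow_ofNat, ← l2norm_sq hf, ← l2norm_sq hg]
  rw [← Real.sqrt_eq_rpow, ← Real.sqrt_eq_rpow, Real.sqrt_sq (l2norm_nonneg _),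
    Real.sqrt_sq (l2norm_nonneg _)]

theorem l2norm_eq_zero_iff {f : Ω → E} (hf : MemLp f 2 μ) : l2norm μ f = 0 ↔ f =ᵐ[μ] 0 := by
  rw [l2norm, ENNReal.toReal_eq_zero_iff, or_iff_left hf.eLpNorm_ne_top,
    eLpNorm_eq_zero_iff hf.aestronglyMeasurable (by norm_num)]

end L2Norm

section Semigroup

theorem exp_zero_smul_apply {X : Type*} [NormedAddCommGroup X] [NormedSpace ℝ X]
    (Φ : X →L[ℝ] X) (x : X) : NormedSpace.exp ((0 : ℝ) • Φ) x = x := by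
  rw [zero_smul, NormedSpace.exp_zero, one_apply_eq_self]

theorem exp_smul_commute {X : Type*} [NormedAddCommGroup X] [NormedSpace ℝ X]
    (Φ : X →L[ℝ] X) (t : ℝ) (x : X) :
    NormedSpace.exp (t • Φ) (Φ x) = Φ (NormedSpace.exp (t • Φ) x) := by
  have : Commute (NormedSpace.exp (t • Φ)) Φ := ((Commute.refl Φ).smul_left t).exp_left
  exact DFunLike.congr_fun this.eq x

variable {X : Type*} [NormedAddCommGroup X] [NormedSpace ℝ X] [CompleteSpace X]

theorem continuous_exp_smul (Φ : X →L[ℝ] X) :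
    Continuous fun t : ℝ => NormedSpace.exp (t • Φ) :=
  continuous_iff_continuousAt.2 fun t => (hasDerivAt_exp_smul_const (𝕂 := ℝ) Φ t).continuousAt

theorem hasIntegralDeriv_exp_smul (Φ : X →L[ℝ] X) (T : ℝ) :
    HasIntegralDeriv (fun t : ℝ => NormedSpace.exp (t • Φ))
      (fun t => NormedSpace.exp (t • Φ) * Φ) T :=
  .of_hasDerivAt (fun t => hasDerivAt_exp_smul_const (𝕂 := ℝ) Φ t)
    ((continuous_exp_smul Φ).mul continuous_const)

theorem exp_smul_mul_exp_smul (Φ : X →L[ℝ] X) (s t : ℝ) :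
    NormedSpace.exp (s • Φ) * NormedSpace.exp (t • Φ) = NormedSpace.exp ((s + t) • Φ) := by
  rw [add_smul, NormedSpace.exp_add_of_commute_of_mem_ball (𝕂 := ℝ)]
  · exact ((Commute.refl Φ).smul_left s).smul_right t
  · simp [NormedSpace.expSeries_radius_eq_top]
  · simp [NormedSpace.expSeries_radius_eq_top]

theorem exp_smul_apply_exp_smul (Φ : X →L[ℝ] X) (s t : ℝ) (x : X) :
    NormedSpace.exp (s • Φ) (NormedSpace.exp (t • Φ) x) = NormedSpace.exp ((s + t) • Φ) x := by
  rw [← exp_smul_mul_exp_smul]; rfl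

theorem intervalIntegrable_exp_apply {T : ℝ} (hT : 0 ≤ T) (Φ : X →L[ℝ] X) {f : ℝ → X}
    (hf : IntervalIntegrable f volume 0 T) {c : ℝ → ℝ} (hc : Continuous c) :
    IntervalIntegrable (fun τ => NormedSpace.exp (c τ • Φ) (f τ)) volume 0 T := by
  have hE : Continuous fun τ => NormedSpace.exp (c τ • Φ) := (continuous_exp_smul Φ).comp hc
  rw [intervalIntegrable_iff_integrableOn_Icc_of_le hT] at hf ⊢
  obtain ⟨M, hM⟩ := isCompact_Icc.exists_bound_of_continuousOn (hE.continuousOn (s := Icc 0 T))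
  refine (hf.norm.const_mul M).mono'
    ((ContinuousLinearMap.id ℝ (X →L[ℝ] X)).aestronglyMeasurable_comp₂
      hE.aestronglyMeasurable hf.aestronglyMeasurable) ?_
  filter_upwards [ae_restrict_mem measurableSet_Icc] with t ht
  exact ContinuousLinearMap.le_of_opNorm_le _ (hM t ht) _

/-- The variation of constants formula gives a solution of the differential equation. -/
theorem hasIntegralDeriv_of_eq_mild {T : ℝ} (hT : 0 ≤ T) (Φ : X →L[ℝ] X) {s f : ℝ → X} {x : X}
    (hf : IntervalIntegrable f volume 0 T)
    (hs : ∀ t ∈ Icc 0 T, s t = NormedSpace.exp (t • Φ) x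
      + ∫ τ in (0 : ℝ)..t, NormedSpace.exp ((t - τ) • Φ) (f τ)) :
    HasIntegralDeriv s (fun t => Φ (s t) + f t) T := by
  have hG : IntervalIntegrable (fun τ => NormedSpace.exp (-τ • Φ) (f τ)) volume 0 T :=
    intervalIntegrable_exp_apply hT Φ hf continuous_neg
  have hJ : HasIntegralDeriv (fun t => x + ∫ τ in (0 : ℝ)..t, NormedSpace.exp (-τ • Φ) (f τ))
      (fun τ => NormedSpace.exp (-τ • Φ) (f τ)) T := ⟨hG, fun t _ => by simp⟩
  have hs' : ∀ t ∈ Icc 0 T, s t = NormedSpace.exp (t • Φ)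
      (x + ∫ τ in (0 : ℝ)..t, NormedSpace.exp (-τ • Φ) (f τ)) := by
    intro t ht
    rw [hs t ht, map_add, ← ContinuousLinearMap.intervalIntegral_comp_comm _
      (hJ.integrable_sub ⟨le_rfl, hT⟩ ht)]
    simp only [exp_smul_apply_exp_smul, sub_eq_add_neg]
  refine ((hasIntegralDeriv_exp_smul Φ T).bilinear (ContinuousLinearMap.id ℝ (X →L[ℝ] X))
    hJ hT).congr hT hs' ?_
  filter_upwards [ae_restrict_mem measurableSet_Icc] with t ht
  simp only [ContinuousLinearMap.coe_id', id_eq, exp_smul_apply_exp_smul, add_neg_cancel,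
    zero_smul, NormedSpace.exp_zero, one_apply_eq_self]
  rw [hs' t ht, add_comm, ← exp_smul_commute]
  rfl

/-- The variation of constants formula for solutions of the differential equation. -/
theorem HasIntegralDeriv.eq_mild {T : ℝ} (hT : 0 ≤ T) {Φ : X →L[ℝ] X} {s f : ℝ → X}
    (hs : HasIntegralDeriv s (fun t => Φ (s t) + f t) T) {t : ℝ} (ht : t ∈ Icc 0 T) :
    s t = NormedSpace.exp (t • Φ) (s 0)
      + ∫ τ in (0 : ℝ)..t, NormedSpace.exp ((t - τ) • Φ) (f τ) := by
  have hE : HasIntegralDeriv (fun t : ℝ => NormedSpace.exp (t • -Φ))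
      (fun t => NormedSpace.exp (t • -Φ) * -Φ) T := hasIntegralDeriv_exp_smul (-Φ) T
  have hP := (hE.bilinear (ContinuousLinearMap.id ℝ (X →L[ℝ] X)) hs hT).congr
    (f₁ := fun t => NormedSpace.exp (-t • Φ) (s t))
    (g₁ := fun t => NormedSpace.exp (-t • Φ) (f t)) hT
    (fun t _ => by simp) (Filter.Eventually.of_forall fun t => by simp)
  have h := congrArg (fun y => (NormedSpace.exp (t • Φ) : X →L[ℝ] X) y) (hP.eq_add t ht)
  rw [map_add, ← ContinuousLinearMap.intervalIntegral_comp_comm _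
      (hP.integrable_sub ⟨le_rfl, hT⟩ ht)] at h
  simpa only [exp_smul_apply_exp_smul, ← sub_eq_add_neg, sub_self, zero_smul,
    NormedSpace.exp_zero, one_apply_eq_self, neg_zero] using h

/-- `L²` and endpoint bounds for a solution of `s' = Φ s + g` with `Φ` stable. -/
theorem stable_bounds {T L α : ℝ} (hT : 0 ≤ T) (hL : 0 ≤ L) (hα : 0 < α) {Φ : X →L[ℝ] X}
    (hΦ : ∀ t : ℝ, 0 ≤ t → ‖NormedSpace.exp (t • Φ)‖ ≤ L * Real.exp (-α * t)) {s g : ℝ → X}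
    (hg : MemLp g 2 (volume.restrict (Icc 0 T)))
    (hs : HasIntegralDeriv s (fun t => Φ (s t) + g t) T) :
    l2norm (volume.restrict (Icc 0 T)) s ≤ L / α * l2norm (volume.restrict (Icc 0 T)) g
        + L / √(2 * α) * ‖s 0‖ ∧
      ‖s T‖ ≤ L * ‖s 0‖ + L / √(2 * α) * l2norm (volume.restrict (Icc 0 T)) g := by
  set ν := volume.restrict (Icc 0 T) with hν
  have hgi : IntervalIntegrable g volume 0 T :=
    (intervalIntegrable_iff_integrableOn_Icc_of_le hT).2 (hg.integrable (by norm_num))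
  have hGi : IntervalIntegrable (fun τ => Real.exp (α * τ) * (L * ‖g τ‖)) volume 0 T :=
    (hgi.norm.const_mul L).continuousOn_mul (by fun_prop)
  have hJ : HasIntegralDeriv
      (fun t => L * ‖s 0‖ + ∫ τ in (0 : ℝ)..t, Real.exp (α * τ) * (L * ‖g τ‖))
      (fun τ => Real.exp (α * τ) * (L * ‖g τ‖)) T := ⟨hGi, fun t _ => by simp⟩
  have hE : HasIntegralDeriv (fun t => Real.exp (-α * t)) (fun t => Real.exp (-α * t) * -α) T :=
    .of_hasDerivAt (fun t => by simpa using ((hasDerivAt_id t).const_mul (-α)).exp) (by fun_prop)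
  set h : ℝ → ℝ := fun t => Real.exp (-α * t) *
    (L * ‖s 0‖ + ∫ τ in (0 : ℝ)..t, Real.exp (α * τ) * (L * ‖g τ‖)) with hh
  have hexp : ∀ t : ℝ, Real.exp (-α * t) * Real.exp (α * t) = 1 := fun t => by
    rw [← Real.exp_add]; simp
  have hhd : HasIntegralDeriv h (fun t => -α * h t + L * ‖g t‖) T := by
    refine (hE.bilinear (ContinuousLinearMap.mul ℝ ℝ) hJ hT).congr hT (fun t _ => rfl)
      (Filter.Eventually.of_forall fun t => ?_)
    simp only [ContinuousLinearMap.mul_apply', hh]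
    rw [← mul_assoc (Real.exp (-α * t)), hexp]
    ring
  have hsh : ∀ t ∈ Icc 0 T, ‖s t‖ ≤ h t := by
    intro t ht
    rw [hs.eq_mild hT ht]
    refine (norm_add_le _ _).trans ?_
    simp only [hh]
    rw [mul_add, ← intervalIntegral.integral_const_mul]
    refine add_le_add ?_ ?_
    · refine (ContinuousLinearMap.le_of_opNorm_le _ (hΦ t ht.1) _).trans (le_of_eq ?_)
      ring
    · refine intervalIntegral.norm_integral_le_of_norm_le ht.1 ?_
        ((hJ.integrable_sub ⟨le_rfl, hT⟩ ht).const_mul _)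
      refine Filter.Eventually.of_forall fun τ hτ => ?_
      refine (ContinuousLinearMap.le_of_opNorm_le _ (hΦ (t - τ) (sub_nonneg.2 hτ.2)) _).trans
        (le_of_eq ?_)
      rw [show -α * (t - τ) = -α * t + α * τ by ring, Real.exp_add]
      ring
  have hhc : ContinuousOn h (Icc 0 T) := hhd.continuousOn hT
  have hh0 : ∀ t ∈ Icc 0 T, 0 ≤ h t := fun t ht => (norm_nonneg _).trans (hsh t ht)
  have hhm : MemLp h 2 ν := by
    obtain ⟨M, hM⟩ := isCompact_Icc.exists_bound_of_continuousOn hhc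
    refine MemLp.of_bound (hhc.aestronglyMeasurable measurableSet_Icc) M ?_
    filter_upwards [ae_restrict_mem measurableSet_Icc] with t ht using hM t ht
  have hH : l2norm ν s ≤ l2norm ν h := by
    refine l2norm_mono hhm ?_
    filter_upwards [ae_restrict_mem measurableSet_Icc] with t ht
    exact (hsh t ht).trans (le_abs_self _)
  have henergy : h T ^ 2 + 2 * α * l2norm ν h ^ 2 ≤
      (L * ‖s 0‖) ^ 2 + 2 * L * (l2norm ν h * l2norm ν g) := by
    have hsq := (hhd.bilinear (ContinuousLinearMap.mul ℝ ℝ) hhd hT).eq_add T ⟨hT, le_rfl⟩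
    have h0 : h 0 = L * ‖s 0‖ := by simp [hh]
    simp only [ContinuousLinearMap.mul_apply', h0] at hsq
    rw [intervalIntegral.integral_of_le hT, ← integral_Icc_eq_integral_Ioc, ← hν] at hsq
    have hI : ∫ t, h t * (-α * h t + L * ‖g t‖) + (-α * h t + L * ‖g t‖) * h t ∂ν =
        ∫ t, 2 * L * (‖h t‖ * ‖g t‖) - 2 * α * ‖h t‖ ^ 2 ∂ν := by
      refine integral_congr_ae ?_
      filter_upwards [ae_restrict_mem measurableSet_Icc] with t ht
      rw [Real.norm_of_nonneg (hh0 t ht)]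
      ring
    rw [hI, integral_sub ((integrable_norm_mul_norm hhm hg).const_mul _)
      (hhm.norm.integrable_sq.const_mul _), integral_const_mul, integral_const_mul,
      ← l2norm_sq hhm] at hsq
    have := mul_le_mul_of_nonneg_left (integral_norm_mul_norm_le hhm hg)
      (by positivity : 0 ≤ 2 * L)
    nlinarith
  set H := l2norm ν h
  set G := l2norm ν g
  have hH0 : 0 ≤ H := l2norm_nonneg _
  have hG0 : 0 ≤ G := l2norm_nonneg _
  have hS0 : 0 ≤ ‖s 0‖ := norm_nonneg _
  set b := L / √(2 * α) with hb
  have hb0 : 0 ≤ b := by positivity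
  have hb2 : b ^ 2 * (2 * α) = L ^ 2 := by
    rw [hb, div_pow, Real.sq_sqrt (by positivity)]
    field_simp
  have ha0 : 0 ≤ L / α := by positivity
  have ha : L / α * α = L := by field_simp
  have hT' : T ∈ Icc 0 T := ⟨hT, le_rfl⟩
  refine ⟨hH.trans ?_, (hsh T hT').trans ?_⟩
  · by_contra! hc
    have h1 : H ^ 2 ≤ b ^ 2 * ‖s 0‖ ^ 2 + L / α * G * H := by
      have : α * H ^ 2 ≤ α * (b ^ 2 * ‖s 0‖ ^ 2 + L / α * G * H) := by
        have : α * (b ^ 2 * ‖s 0‖ ^ 2 + L / α * G * H) =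
          (b ^ 2 * (2 * α)) * ‖s 0‖ ^ 2 / 2 + (L / α * α) * G * H := by ring
        rw [this, hb2, ha]
        nlinarith [sq_nonneg (h T)]
      exact le_of_mul_le_mul_left this hα
    have h2 : 0 ≤ L / α * G := by positivity
    have h3 : 0 ≤ b * ‖s 0‖ := by positivity
    nlinarith
  · have h2 : 0 ≤ L * ‖s 0‖ + b * G := by positivity
    refine abs_le_of_sq_le_sq' ?_ h2 |>.2
    have h3 : 2 * L * (H * G) ≤ 2 * α * H ^ 2 + b ^ 2 * G ^ 2 := by
      have : 0 ≤ (2 * α * H - L * G) ^ 2 / (2 * α) := by positivity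
      have e : (2 * α * H - L * G) ^ 2 / (2 * α) =
          2 * α * H ^ 2 - 2 * L * (H * G) + L ^ 2 * G ^ 2 / (2 * α) := by
        field_simp; ring
      have e2 : b ^ 2 * G ^ 2 = L ^ 2 * G ^ 2 / (2 * α) := by
        rw [← hb2]; field_simp
      linarith
    have h4 : 0 ≤ L * ‖s 0‖ * (b * G) := by positivity
    nlinarith

end Semigroup

section Constants

variable {L α : ℝ}

theorem le_sq_mul_dTilde (hL : 1 ≤ L) (hα : 0 < α) :
    L ^ 3 * (1 + L) * (1 + 2 * L) + L ^ 2 * (1 + 2 * L) ^ 2 ≤ dTilde L α * α ^ 2 := by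
  have h1 : L ^ 2 * (1 + L) ≤ √(α ^ 2 + L ^ 4 * (1 + L) ^ 2) :=
    Real.le_sqrt_of_sq_le (by nlinarith [sq_nonneg α])
  have h2 := le_max_left 1 (L ^ 2 * (1 + L) ^ 2 / (1 + 2 * L) ^ 2)
  have e : dTilde L α * α ^ 2 = L * (1 + 2 * L) * √(α ^ 2 + L ^ 4 * (1 + L) ^ 2) +
      L ^ 2 * (1 + 2 * L) ^ 2 * max 1 (L ^ 2 * (1 + L) ^ 2 / (1 + 2 * L) ^ 2) := by
    rw [dTilde]; field_simp
  rw [e]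
  refine add_le_add ?_ (le_mul_of_one_le_right (by positivity) h2)
  calc L ^ 3 * (1 + L) * (1 + 2 * L) = L * (1 + 2 * L) * (L ^ 2 * (1 + L)) := by ring
    _ ≤ _ := by gcongr

theorem dTilde_pos (hL : 1 ≤ L) (hα : 0 < α) : 0 < dTilde L α := by
  have := le_sq_mul_dTilde hL hα
  have h : 0 < dTilde L α * α ^ 2 := lt_of_lt_of_le (by positivity) this
  exact pos_of_mul_pos_left h (by positivity)

theorem le_dTilde (hL : 1 ≤ L) (hα : 0 < α) (hαL : α ≤ L * (1 + L)) : L ≤ dTilde L α := by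
  have h := le_sq_mul_dTilde hL hα
  have hL0 : 0 < L := by linarith
  have h2 : α ^ 2 ≤ (L * (1 + L)) ^ 2 := by gcongr
  refine le_of_mul_le_mul_right (le_trans ?_ h) (by positivity : 0 < α ^ 2)
  calc L * α ^ 2 ≤ L * (L * (1 + L)) ^ 2 := by gcongr
    _ = L ^ 3 * (1 + L) * (1 + L) := by ring
    _ ≤ L ^ 3 * (1 + L) * (1 + 2 * L) := by gcongr; linarith
    _ ≤ _ := le_add_of_nonneg_right (by positivity)

theorem one_add_le_dTilde (hL : 1 ≤ L) (hα : 0 < α) (hαL : α ≤ L * (1 + L)) :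
    1 + 4 * (L / α) ^ 2 * L ^ 2 ≤ dTilde L α := by
  have h := le_sq_mul_dTilde hL hα
  have hL0 : 0 < L := by linarith
  have h2 : α ^ 2 ≤ (L * (1 + L)) ^ 2 := by gcongr
  refine le_of_mul_le_mul_right (le_trans ?_ h) (by positivity : 0 < α ^ 2)
  have e : (1 + 4 * (L / α) ^ 2 * L ^ 2) * α ^ 2 = α ^ 2 + 4 * L ^ 4 := by field_simp
  rw [e]
  have h3 : (L * (1 + L)) ^ 2 ≤ L ^ 3 * (1 + L) * (1 + 2 * L) := by
    have : 0 ≤ L ^ 2 * (1 + L) * (2 * L ^ 2 - 1) :=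
      mul_nonneg (by positivity) (by nlinarith)
    nlinarith
  nlinarith [pow_pos hL0 3, pow_pos hL0 2]

theorem sqrt_one_add_sq_le (hL : 0 ≤ L) : √(1 + L ^ 2) ≤ 1 + L :=
  Real.sqrt_le_iff.2 ⟨by linarith, by nlinarith⟩

theorem div_mul_sqrt_le_dTilde (hL : 1 ≤ L) (hα : 0 < α) (hαL : α ≤ L * (1 + L)) :
    L / α * √(1 + L ^ 2) ≤ dTilde L α / 2 := by
  have h := le_sq_mul_dTilde hL hα
  have hL0 : 0 < L := by linarith
  refine le_of_mul_le_mul_right ?_ (by positivity : 0 < α ^ 2)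
  have hn := sqrt_one_add_sq_le hL0.le
  calc L / α * √(1 + L ^ 2) * α ^ 2 = L * √(1 + L ^ 2) * α := by field_simp
    _ ≤ L * (1 + L) * (L * (1 + L)) := by gcongr
    _ ≤ dTilde L α / 2 * α ^ 2 := by nlinarith [pow_pos hL0 3, pow_pos hL0 4, pow_pos hL0 5]

theorem sqrt_le_of_le (hL : 1 ≤ L) (hαL : α ≤ L * (1 + L)) : √α ≤ (1 + 2 * L) / 2 :=
  Real.sqrt_le_iff.2 ⟨by linarith, by nlinarith⟩

theorem sq_div_sqrt_le_dTilde (hL : 1 ≤ L) (hα : 0 < α) (hαL : α ≤ L * (1 + L)) :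
    L ^ 2 / √α ≤ dTilde L α / 2 := by
  have h := le_sq_mul_dTilde hL hα
  have hL0 : 0 < L := by linarith
  have hs : 0 < √α := Real.sqrt_pos.2 hα
  have hss : √α ^ 2 = α := Real.sq_sqrt hα.le
  refine le_of_mul_le_mul_right ?_ (by positivity : 0 < α ^ 2)
  have hn := sqrt_le_of_le hL hαL
  calc L ^ 2 / √α * α ^ 2 = L ^ 2 / √α * (√α ^ 2 * α) := by rw [hss]; ring
    _ = L ^ 2 * √α * α := by field_simp
    _ ≤ L ^ 2 * ((1 + 2 * L) / 2) * (L * (1 + L)) := by gcongr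
    _ ≤ dTilde L α / 2 * α ^ 2 := by
      have : 0 ≤ L ^ 2 * (1 + 2 * L) ^ 2 := by positivity
      nlinarith

theorem sqrt_two_mul_eq (hα : 0 < α) : √2 * L * (L / √(2 * α)) = L ^ 2 / √α := by
  have hs : 0 < √α := Real.sqrt_pos.2 hα
  have h2 : 0 < √(2 : ℝ) := by positivity
  rw [Real.sqrt_mul (by norm_num)]
  field_simp

theorem sqrt_two_mul_mul_le_dTilde (hL : 1 ≤ L) (hα : 0 < α) (hαL : α ≤ L * (1 + L)) :
    √2 * L * (L / √(2 * α)) * √(1 + 4 * (L / α) ^ 2 * L ^ 2) ≤ 3 / 2 * dTilde L α := by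
  rw [sqrt_two_mul_eq hα]
  have h := le_sq_mul_dTilde hL hα
  have h1 := sq_div_sqrt_le_dTilde hL hα hαL
  have hL0 : 0 < L := by linarith
  have hs : 0 < √α := Real.sqrt_pos.2 hα
  have hss : √α ^ 2 = α := Real.sq_sqrt hα.le
  have hk : √(1 + 4 * (L / α) ^ 2 * L ^ 2) ≤ 1 + 2 * (L / α) * L := by
    refine Real.sqrt_le_iff.2 ⟨by positivity, ?_⟩
    have : 0 ≤ L / α * L := by positivity
    nlinarith
  have hn := sqrt_le_of_le hL hαL
  have h2 : L ^ 2 / √α * (2 * (L / α) * L) ≤ dTilde L α := by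
    refine le_of_mul_le_mul_right ?_ (by positivity : 0 < α ^ 2)
    calc L ^ 2 / √α * (2 * (L / α) * L) * α ^ 2
        = 2 * L ^ 4 / √α * α := by field_simp
      _ = 2 * L ^ 4 / √α * √α ^ 2 := by rw [hss]
      _ = 2 * L ^ 4 * √α := by field_simp
      _ ≤ 2 * L ^ 4 * ((1 + 2 * L) / 2) := by gcongr
      _ ≤ dTilde L α * α ^ 2 := by
        have : 0 ≤ L ^ 2 * (1 + 2 * L) ^ 2 := by positivity
        have : 0 ≤ L ^ 3 * (1 + 2 * L) := by positivity
        nlinarith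
  calc _ ≤ L ^ 2 / √α * (1 + 2 * (L / α) * L) := by gcongr
    _ = L ^ 2 / √α + L ^ 2 / √α * (2 * (L / α) * L) := by ring
    _ ≤ _ := by linarith

theorem mul_sqrt_le_dTilde (hL : 1 ≤ L) (hα : 0 < α) (hαL : α ≤ L * (1 + L)) :
    L / √(2 * α) * √(1 + L ^ 2) ≤ dTilde L α / 2 := by
  refine le_trans ?_ (sq_div_sqrt_le_dTilde hL hα hαL)
  rw [← sqrt_two_mul_eq hα, mul_comm]
  gcongr
  refine Real.sqrt_le_iff.2 ⟨by positivity, ?_⟩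
  rw [mul_pow, Real.sq_sqrt (by norm_num)]
  nlinarith

end Constants

section Triples

theorem sqrt_sum_sq_add_le (y₁ y₂ y₃ z₁ z₂ z₃ : ℝ) :
    √((y₁ + z₁) ^ 2 + (y₂ + z₂) ^ 2 + (y₃ + z₃) ^ 2) ≤
      √(y₁ ^ 2 + y₂ ^ 2 + y₃ ^ 2) + √(z₁ ^ 2 + z₂ ^ 2 + z₃ ^ 2) := by
  have := norm_add_le (!₂[y₁, y₂, y₃] : EuclideanSpace ℝ (Fin 3)) !₂[z₁, z₂, z₃]
  simpa [EuclideanSpace.norm_eq, Fin.sum_univ_three] using this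

theorem sqrt_sum_sq_mono {x₁ x₂ x₃ y₁ y₂ y₃ : ℝ} (h₁ : 0 ≤ x₁) (h₂ : 0 ≤ x₂) (h₃ : 0 ≤ x₃)
    (h₁' : x₁ ≤ y₁) (h₂' : x₂ ≤ y₂) (h₃' : x₃ ≤ y₃) :
    √(x₁ ^ 2 + x₂ ^ 2 + x₃ ^ 2) ≤ √(y₁ ^ 2 + y₂ ^ 2 + y₃ ^ 2) := by
  gcongr

theorem sum_mul_le_sqrt_mul_sqrt (x₁ x₂ x₃ y₁ y₂ y₃ : ℝ) :
    x₁ * y₁ + x₂ * y₂ + x₃ * y₃ ≤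
      √(x₁ ^ 2 + x₂ ^ 2 + x₃ ^ 2) * √(y₁ ^ 2 + y₂ ^ 2 + y₃ ^ 2) := by
  rw [← Real.sqrt_mul (by positivity)]
  refine Real.le_sqrt_of_sq_le ?_
  nlinarith [sq_nonneg (x₁ * y₂ - x₂ * y₁), sq_nonneg (x₁ * y₃ - x₃ * y₁),
    sq_nonneg (x₂ * y₃ - x₃ * y₂)]

end Triples

section ScalarEstimate

variable {L α : ℝ}

theorem le_of_energy_bounds (hL : 1 ≤ L) (hα : 0 < α) (hαL : α ≤ L * (1 + L))
    {P Q V Z S : ℝ} (hP : 0 ≤ P) (hQ : 0 ≤ Q) (hV : 0 ≤ V) (hS : 0 ≤ S)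
    (hZ0 : 0 ≤ Z) (hQP : Q ≤ P + Z / (4 * dTilde L α))
    (hZ : Z ≤ √(1 + 4 * (L / α) ^ 2 * L ^ 2) * V + L / α * √(1 + L ^ 2) * Q + L / √(2 * α) * S)
    (hVV : V ^ 2 ≤ Q * Z + L / √(2 * α) * S * (√2 * L * V + √(1 + L ^ 2) * Q) + L / 2 * S ^ 2) :
    Z ≤ 8 * dTilde L α * (P + S) := by
  have c1 := one_add_le_dTilde hL hα hαL
  have c2 := div_mul_sqrt_le_dTilde hL hα hαL
  have c3 := mul_sqrt_le_dTilde hL hα hαL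
  have c4 := sqrt_two_mul_mul_le_dTilde hL hα hαL
  have c5 := le_dTilde hL hα hαL
  have hD := dTilde_pos hL hα
  have hk2 : √(1 + 4 * (L / α) ^ 2 * L ^ 2) ^ 2 = 1 + 4 * (L / α) ^ 2 * L ^ 2 :=
    Real.sq_sqrt (by positivity)
  have hn1 : 1 ≤ √(1 + L ^ 2) := Real.one_le_sqrt.2 (by nlinarith)
  have hb0 : 0 ≤ L / √(2 * α) := by positivity
  have hk0 : 0 ≤ √(1 + 4 * (L / α) ^ 2 * L ^ 2) := Real.sqrt_nonneg _
  set D := dTilde L α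
  set b := L / √(2 * α)
  set n := √(1 + L ^ 2)
  set k := √(1 + 4 * (L / α) ^ 2 * L ^ 2)
  rw [← hk2] at c1
  have c6 : b ≤ D / 2 := (le_mul_of_one_le_right hb0 hn1).trans c3
  set y := D * (P + S) with hy
  have hy0 : 0 ≤ y := by positivity
  have hPy : D * P ≤ y := by rw [hy, mul_add]; exact le_add_of_nonneg_right (by positivity)
  have hSy : D * S ≤ y := by rw [hy, mul_add]; exact le_add_of_nonneg_left (by positivity)
  have hDQ : D * Q ≤ y + Z / 4 := by
    calc D * Q ≤ D * (P + Z / (4 * D)) := by gcongr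
      _ = D * P + Z / 4 := by field_simp
      _ ≤ _ := by gcongr
  set X := k * V with hX
  have hX0 : 0 ≤ X := by positivity
  have e1 : Z ≤ X + (y + Z / 4) / 2 + y / 2 := by
    have i1 : L / α * n * Q ≤ D / 2 * Q := by gcongr
    have i2 : b * S ≤ D / 2 * S := by gcongr
    linarith
  have e2 : X ^ 2 ≤ (y + Z / 4) * Z + y * (y + Z / 4) / 2 + 3 / 2 * y * X + y ^ 2 / 2 := by
    have j1 : k ^ 2 * (Q * Z) ≤ (y + Z / 4) * Z := by
      calc k ^ 2 * (Q * Z) ≤ D * (Q * Z) := by gcongr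
        _ = D * Q * Z := by ring
        _ ≤ _ := by gcongr
    have j2 : k ^ 2 * (b * S * (n * Q)) ≤ y * (y + Z / 4) / 2 := by
      calc k ^ 2 * (b * S * (n * Q)) = k ^ 2 * ((b * n) * S * Q) := by ring
        _ ≤ D * (D / 2 * S * Q) := by gcongr
        _ = (D * S) * (D * Q) / 2 := by ring
        _ ≤ _ := by gcongr
    have j3 : k ^ 2 * (b * S * (√2 * L * V)) ≤ 3 / 2 * y * X := by
      calc k ^ 2 * (b * S * (√2 * L * V)) = (√2 * L * b * k) * S * X := by rw [hX]; ring
        _ ≤ (3 / 2 * D) * S * X := by gcongr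
        _ = 3 / 2 * (D * S) * X := by ring
        _ ≤ _ := by gcongr
    have j4 : k ^ 2 * (L / 2 * S ^ 2) ≤ y ^ 2 / 2 := by
      calc k ^ 2 * (L / 2 * S ^ 2) ≤ D * (D / 2 * S ^ 2) := by gcongr
        _ = (D * S) ^ 2 / 2 := by ring
        _ ≤ _ := by gcongr
    calc X ^ 2 = k ^ 2 * V ^ 2 := by rw [hX]; ring
      _ ≤ k ^ 2 * (Q * Z + b * S * (√2 * L * V + n * Q) + L / 2 * S ^ 2) := by gcongr
      _ = k ^ 2 * (Q * Z) + k ^ 2 * (b * S * (n * Q)) + k ^ 2 * (b * S * (√2 * L * V)) +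
          k ^ 2 * (L / 2 * S ^ 2) := by ring
      _ ≤ _ := by gcongr
  have e3 : 8 * D * (P + S) = 8 * y := by rw [hy]; ring
  rw [e3]
  by_contra! hc
  have f1 : 0 ≤ X - (7 / 8 * Z - y) := by linarith
  have f2 : 0 ≤ X + (7 / 8 * Z - y) - 3 / 2 * y := by linarith
  have f3 := mul_nonneg f1 f2
  have f4 := mul_pos (by linarith : 0 < Z - 8 * y) (by linarith : 0 < Z - 4 / 33 * y)
  linarith [sq_nonneg y]

/-- Combines the closed loop bounds and the energy identity into a bound of the solution `L²` norm
`√(Ns² + Nu² + Nl²)`; here `Ns, Nu, Nl, Nc` are norms of `s, u, λ, C s`, `Nq, Nr, Nd` are norms of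
the data, and `S, S', sT, l0` are the norms of `s 0, λ T, s T, λ 0`. -/
theorem solution_norm_le (hL : 1 ≤ L) (hα : 0 < α) (hαL : α ≤ L * (1 + L))
    {Ns Nu Nl Nc Nq Nr Nd S S' sT l0 P : ℝ} (hNs : 0 ≤ Ns) (hNu : 0 ≤ Nu) (hNl : 0 ≤ Nl)
    (hS : 0 ≤ S) (hS' : 0 ≤ S')
    (hP : 0 ≤ P)
    (h1 : Ns ≤ L / α * (L * Nc + L * Nu + Nd) + L / √(2 * α) * S)
    (h2 : sT ≤ L * S + L / √(2 * α) * (L * Nc + L * Nu + Nd))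
    (h3 : Nl ≤ L / α * (L * Nu + L * Nr + L * Nc + Nq) + L / √(2 * α) * S')
    (h4 : l0 ≤ L * S' + L / √(2 * α) * (L * Nu + L * Nr + L * Nc + Nq))
    (h5 : Nc ^ 2 + Nu ^ 2 ≤ S' * sT + l0 * S + (Nq * Ns + Nr * Nu + Nd * Nl))
    (hQ : √(Nq ^ 2 + Nr ^ 2 + Nd ^ 2) ≤
      P + √(Ns ^ 2 + Nu ^ 2 + Nl ^ 2) / (4 * dTilde L α)) :
    √(Ns ^ 2 + Nu ^ 2 + Nl ^ 2) ≤ 8 * dTilde L α * (P + (S + S')) := by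
  have hL0 : 0 < L := by linarith
  have ha0 : 0 ≤ L / α := by positivity
  have hb0 : 0 ≤ L / √(2 * α) := by positivity
  set Z := √(Ns ^ 2 + Nu ^ 2 + Nl ^ 2) with hZ
  set Q := √(Nq ^ 2 + Nr ^ 2 + Nd ^ 2) with hQdef
  set V := √(Nc ^ 2 + Nu ^ 2) with hV
  have hV0 : 0 ≤ V := Real.sqrt_nonneg _
  have hV2 : V ^ 2 = Nc ^ 2 + Nu ^ 2 := Real.sq_sqrt (by positivity)
  have hQ0 : 0 ≤ Q := Real.sqrt_nonneg _
  have hQ2 : Q ^ 2 = Nq ^ 2 + Nr ^ 2 + Nd ^ 2 := Real.sq_sqrt (by positivity)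
  have hn0 : 0 ≤ √(1 + L ^ 2) := Real.sqrt_nonneg _
  have hn2 : √(1 + L ^ 2) ^ 2 = 1 + L ^ 2 := Real.sq_sqrt (by positivity)
  have hCU : L * Nc + L * Nu ≤ √2 * L * V := by
    have : Nc + Nu ≤ √2 * V := by
      refine abs_le_of_sq_le_sq' ?_ (by positivity) |>.2
      rw [mul_pow, hV2, Real.sq_sqrt (by norm_num)]
      linarith [sq_nonneg (Nc - Nu)]
    have := mul_le_mul_of_nonneg_left this hL0.le
    linarith
  have hNuV : Nu ≤ V := Real.le_sqrt_of_sq_le (le_add_of_nonneg_left (sq_nonneg _))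
  have hRQ : (L * Nr + Nq) ^ 2 + Nd ^ 2 ≤ (√(1 + L ^ 2) * Q) ^ 2 := by
    rw [mul_pow, hn2, hQ2]
    linarith [sq_nonneg (L * Nq - Nr), sq_nonneg (L * Nd)]
  have hdQ : Nd ≤ √(1 + L ^ 2) * Q :=
    abs_le_of_sq_le_sq' (by linarith [sq_nonneg (L * Nr + Nq)]) (by positivity) |>.2
  have hrQ : L * Nr + Nq ≤ √(1 + L ^ 2) * Q :=
    abs_le_of_sq_le_sq' (by linarith [sq_nonneg Nd]) (by positivity) |>.2
  refine le_of_energy_bounds hL hα hαL hP hQ0 hV0 (by positivity) (Real.sqrt_nonneg _) hQ ?_ ?_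
  · set y := L / α * (√2 * L * V)
    have i1 : Z ≤ √((y + L / α * Nd + L / √(2 * α) * S) ^ 2 + (V + 0 + 0) ^ 2 +
        (y + L / α * (L * Nr + Nq) + L / √(2 * α) * S') ^ 2) := by
      refine sqrt_sum_sq_mono hNs hNu hNl ?_ (by linarith) ?_
      · have := mul_le_mul_of_nonneg_left hCU ha0
        linarith
      · have := mul_le_mul_of_nonneg_left hCU ha0
        linarith
    refine i1.trans ((sqrt_sum_sq_add_le _ _ _ _ _ _).trans (add_le_add
      ((sqrt_sum_sq_add_le _ _ _ _ _ _).trans (add_le_add ?_ ?_)) ?_))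
    · refine Real.sqrt_le_iff.2 ⟨by positivity, ?_⟩
      have hk : (√(1 + 4 * (L / α) ^ 2 * L ^ 2) * V) ^ 2 =
          (1 + 4 * (L / α) ^ 2 * L ^ 2) * V ^ 2 := by
        rw [mul_pow, Real.sq_sqrt (by positivity)]
      have : y ^ 2 = 2 * (L / α) ^ 2 * L ^ 2 * V ^ 2 := by
        simp only [y, mul_pow]
        rw [Real.sq_sqrt (by norm_num)]
        ring
      rw [hk, this]
      exact le_of_eq (by ring)
    · refine Real.sqrt_le_iff.2 ⟨by positivity, ?_⟩
      have := mul_le_mul_of_nonneg_left hRQ (sq_nonneg (L / α))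
      linarith
    · refine Real.sqrt_le_iff.2 ⟨by positivity, ?_⟩
      have : 0 ≤ (L / √(2 * α)) ^ 2 * (S * S') := by positivity
      linarith
  · have k1 : S' * sT ≤ S' * (L * S + L / √(2 * α) * (√2 * L * V + √(1 + L ^ 2) * Q)) := by
      refine mul_le_mul_of_nonneg_left (h2.trans ?_) hS'
      gcongr
    have k2 : l0 * S ≤ (L * S' + L / √(2 * α) * (√2 * L * V + √(1 + L ^ 2) * Q)) * S := by
      refine mul_le_mul_of_nonneg_right (h4.trans ?_) hS
      have : L * Nu + L * Nr + L * Nc + Nq ≤ √2 * L * V + √(1 + L ^ 2) * Q := by linarith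
      gcongr
    have k3 := sum_mul_le_sqrt_mul_sqrt Nq Nr Nd Ns Nu Nl
    rw [hV2]
    linarith [mul_nonneg hL0.le (sq_nonneg (S - S'))]

end ScalarEstimate

open scoped InnerProductSpace
open ContinuousLinearMap (adjoint)

theorem memLp_of_continuousOn {E : Type*} [NormedAddCommGroup E] {T : ℝ} {f : ℝ → E}
    (hf : ContinuousOn f (Icc 0 T)) : MemLp f 2 (volume.restrict (Icc 0 T)) := by
  obtain ⟨M, hM⟩ := isCompact_Icc.exists_bound_of_continuousOn hf
  refine MemLp.of_bound (hf.aestronglyMeasurable measurableSet_Icc) M ?_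
  filter_upwards [ae_restrict_mem measurableSet_Icc] with t ht using hM t ht

theorem memLp_smul_of_continuousOn {E : Type*} [NormedAddCommGroup E] [NormedSpace ℝ E] {T : ℝ}
    {w : ℝ → ℝ} (hw : ContinuousOn w (Icc 0 T)) {f : ℝ → E}
    (hf : MemLp f 2 (volume.restrict (Icc 0 T))) :
    MemLp (fun t => w t • f t) 2 (volume.restrict (Icc 0 T)) := by
  obtain ⟨M, hM⟩ := isCompact_Icc.exists_bound_of_continuousOn hw
  refine hf.of_le_mul (c := M)
    ((hw.aestronglyMeasurable measurableSet_Icc).smul hf.aestronglyMeasurable) ?_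
  filter_upwards [ae_restrict_mem measurableSet_Icc] with t ht
  rw [norm_smul]
  gcongr
  exact hM t ht

theorem measurePreserving_reflect (T : ℝ) :
    MeasurePreserving (fun t : ℝ => T - t) (volume.restrict (Icc 0 T))
      (volume.restrict (Icc 0 T)) := by
  have := (Measure.measurePreserving_sub_left (volume : Measure ℝ) T).restrict_preimage
    (measurableSet_Icc (a := 0) (b := T))
  simpa using this

theorem l2norm_reflect {E : Type*} [NormedAddCommGroup E] {T : ℝ} {f : ℝ → E}
    (hf : MemLp f 2 (volume.restrict (Icc 0 T))) :
    l2norm (volume.restrict (Icc 0 T)) (fun t => f (T - t)) =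
      l2norm (volume.restrict (Icc 0 T)) f := by
  rw [l2norm, l2norm]
  congr 1
  exact eLpNorm_comp_measurePreserving hf.aestronglyMeasurable (measurePreserving_reflect T)

theorem norm_exp_le {A : Type*} [NormedRing A] [NormOneClass A] [NormedAlgebra ℝ A]
    [CompleteSpace A] (x : A) : ‖NormedSpace.exp x‖ ≤ Real.exp ‖x‖ := by
  have h1 := NormedSpace.exp_series_hasSum_exp' (𝕂 := ℝ) x
  have h2 := NormedSpace.exp_series_hasSum_exp' (𝕂 := ℝ) ‖x‖
  rw [← Real.exp_eq_exp_ℝ] at h2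
  rw [← h1.tsum_eq]
  refine tsum_of_norm_bounded h2 fun n => ?_
  rw [norm_smul, smul_eq_mul, Real.norm_of_nonneg (by positivity)]
  gcongr
  exact norm_pow_le x n

theorem le_norm_of_stable {X : Type*} [NormedAddCommGroup X] [NormedSpace ℝ X] [CompleteSpace X]
    [Nontrivial X] {L α : ℝ} (hL : 0 < L) {Φ : X →L[ℝ] X}
    (hΦ : ∀ t : ℝ, 0 ≤ t → ‖NormedSpace.exp (t • Φ)‖ ≤ L * Real.exp (-α * t)) : α ≤ ‖Φ‖ := by
  by_contra! hc
  have hδ : 0 < α - ‖Φ‖ := sub_pos.2 hc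
  set t := L / (α - ‖Φ‖) with ht
  have ht0 : 0 < t := by positivity
  have h1 : (1 : ℝ) ≤ L * Real.exp (-α * t) * Real.exp (t * ‖Φ‖) := by
    calc (1 : ℝ) = ‖NormedSpace.exp (t • Φ) * NormedSpace.exp (-t • Φ)‖ := by
          rw [exp_smul_mul_exp_smul]; simp
      _ ≤ ‖NormedSpace.exp (t • Φ)‖ * ‖NormedSpace.exp (-t • Φ)‖ := norm_mul_le _ _
      _ ≤ _ := by
        gcongr
        · exact hΦ t ht0.le
        · refine (norm_exp_le _).trans (le_of_eq ?_)
          rw [norm_smul, norm_neg, Real.norm_of_nonneg ht0.le]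
  have h2 : t * (α - ‖Φ‖) = L := by rw [ht]; field_simp
  rw [mul_assoc, ← Real.exp_add, show -α * t + t * ‖Φ‖ = -L by linarith, Real.exp_neg] at h1
  have h3 := Real.add_one_le_exp L
  rw [← div_eq_mul_inv, le_div_iff₀ (Real.exp_pos _)] at h1
  linarith

section StrongSolution

variable {X U Y : Type*} [NormedAddCommGroup X] [InnerProductSpace ℝ X] [CompleteSpace X]
  [NormedAddCommGroup U] [InnerProductSpace ℝ U] [CompleteSpace U]
  [NormedAddCommGroup Y] [InnerProductSpace ℝ Y] [CompleteSpace Y]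

theorem norm_exp_smul_adjoint (Φ : X →L[ℝ] X) (t : ℝ) :
    ‖NormedSpace.exp (t • adjoint Φ)‖ = ‖NormedSpace.exp (t • Φ)‖ := by
  have : t • adjoint Φ = star (t • Φ) := by
    rw [star_smul, ContinuousLinearMap.star_eq_adjoint]; simp
  rw [this, ← NormedSpace.star_exp, norm_star]

/-- The optimality system as a two point boundary value problem for integral functions. -/
structure IsStrongSolution (Λ : X →L[ℝ] X) (B : U →L[ℝ] X) (C : X →L[ℝ] Y) (T : ℝ)
    (q : ℝ → X) (r : ℝ → U) (d : ℝ → X) (s : ℝ → X) (u : ℝ → U) (lam : ℝ → X) : Prop where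
  memLp_q : MemLp q 2 (volume.restrict (Icc 0 T))
  memLp_r : MemLp r 2 (volume.restrict (Icc 0 T))
  memLp_d : MemLp d 2 (volume.restrict (Icc 0 T))
  memLp_u : MemLp u 2 (volume.restrict (Icc 0 T))
  state : HasIntegralDeriv s (fun t => Λ (s t) + (B (u t) + d t)) T
  costate : HasIntegralDeriv lam
    (fun t => -(adjoint Λ (lam t) + (q t - adjoint C (C (s t))))) T
  control : ∀ᵐ t ∂(volume.restrict (Icc 0 T)), u t = r t + adjoint B (lam t)

namespace IsStrongSolution

variable {Λ : X →L[ℝ] X} {B : U →L[ℝ] X} {C : X →L[ℝ] Y} {T : ℝ} {q : ℝ → X} {r : ℝ → U}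
  {d : ℝ → X} {s : ℝ → X} {u : ℝ → U} {lam : ℝ → X} {L α : ℝ}

theorem memLp_s (h : IsStrongSolution Λ B C T q r d s u lam) (hT : 0 ≤ T) :
    MemLp s 2 (volume.restrict (Icc 0 T)) :=
  memLp_of_continuousOn (h.state.continuousOn hT)

theorem memLp_lam (h : IsStrongSolution Λ B C T q r d s u lam) (hT : 0 ≤ T) :
    MemLp lam 2 (volume.restrict (Icc 0 T)) :=
  memLp_of_continuousOn (h.costate.continuousOn hT)

theorem sub {q' d' s' lam' : ℝ → X} {r' u' : ℝ → U}
    (h : IsStrongSolution Λ B C T q r d s u lam)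
    (h' : IsStrongSolution Λ B C T q' r' d' s' u' lam') :
    IsStrongSolution Λ B C T (fun t => q t - q' t) (fun t => r t - r' t) (fun t => d t - d' t)
      (fun t => s t - s' t) (fun t => u t - u' t) (fun t => lam t - lam' t) where
  memLp_q := h.memLp_q.sub h'.memLp_q
  memLp_r := h.memLp_r.sub h'.memLp_r
  memLp_d := h.memLp_d.sub h'.memLp_d
  memLp_u := h.memLp_u.sub h'.memLp_u
  state := by
    convert h.state.sub h'.state using 2 with t
    simp only [map_sub]; abel
  costate := by
    convert h.costate.sub h'.costate using 2 with t
    simp only [map_sub]; abel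
  control := by
    filter_upwards [h.control, h'.control] with t h1 h2
    rw [h1, h2, map_sub]; abel

theorem congr {q' d' : ℝ → X} {r' : ℝ → U} (hT : 0 ≤ T)
    (h : IsStrongSolution Λ B C T q r d s u lam)
    (hq : ∀ᵐ t ∂(volume.restrict (Icc 0 T)), q' t = q t)
    (hr : ∀ᵐ t ∂(volume.restrict (Icc 0 T)), r' t = r t)
    (hd : ∀ᵐ t ∂(volume.restrict (Icc 0 T)), d' t = d t) :
    IsStrongSolution Λ B C T q' r' d' s u lam where
  memLp_q := (memLp_congr_ae hq).2 h.memLp_q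
  memLp_r := (memLp_congr_ae hr).2 h.memLp_r
  memLp_d := (memLp_congr_ae hd).2 h.memLp_d
  memLp_u := h.memLp_u
  state := h.state.congr hT (fun _ _ => rfl) (by filter_upwards [hd] with t ht; rw [ht])
  costate := h.costate.congr hT (fun _ _ => rfl) (by filter_upwards [hq] with t ht; rw [ht])
  control := by filter_upwards [h.control, hr] with t h1 h2; rw [h1, h2]

theorem state_bounds (h : IsStrongSolution Λ B C T q r d s u lam) (hT : 0 ≤ T) (hL : 0 ≤ L)
    (hα : 0 < α) (hB : ‖B‖ ≤ L) {K : Y →L[ℝ] X} (hK : ‖K‖ ≤ L)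
    (hstab : ∀ t : ℝ, 0 ≤ t →
      ‖NormedSpace.exp (t • (Λ - K ∘L C))‖ ≤ L * Real.exp (-α * t)) :
    l2norm (volume.restrict (Icc 0 T)) s ≤
        L / α * (L * l2norm (volume.restrict (Icc 0 T)) (fun t => C (s t))
          + L * l2norm (volume.restrict (Icc 0 T)) u + l2norm (volume.restrict (Icc 0 T)) d)
        + L / √(2 * α) * ‖s 0‖ ∧
      ‖s T‖ ≤ L * ‖s 0‖ + L / √(2 * α) *
        (L * l2norm (volume.restrict (Icc 0 T)) (fun t => C (s t))
          + L * l2norm (volume.restrict (Icc 0 T)) u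
          + l2norm (volume.restrict (Icc 0 T)) d) := by
  have hCs : MemLp (fun t => C (s t)) 2 (volume.restrict (Icc 0 T)) :=
    C.comp_memLp' (h.memLp_s hT)
  have m1 : MemLp (fun t => K (C (s t))) 2 (volume.restrict (Icc 0 T)) := K.comp_memLp' hCs
  have m2 : MemLp (fun t => B (u t)) 2 (volume.restrict (Icc 0 T)) := B.comp_memLp' h.memLp_u
  have hode : HasIntegralDeriv s
      (fun t => (Λ - K ∘L C) (s t) + (K (C (s t)) + B (u t) + d t)) T :=
    h.state.congr hT (fun _ _ => rfl) (Filter.Eventually.of_forall fun t => by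
      simp only [sub_apply, ContinuousLinearMap.comp_apply]; abel)
  have hg := (l2norm_add_le (m1.add m2) h.memLp_d).trans
    (add_le_add_left ((l2norm_add_le m1 m2).trans
      (add_le_add (l2norm_clm_le K hK hCs) (l2norm_clm_le B hB h.memLp_u))) _)
  obtain ⟨b1, b2⟩ := stable_bounds hT hL hα hstab ((m1.add m2).add h.memLp_d) hode
  refine ⟨b1.trans ?_, b2.trans ?_⟩
  · gcongr
    exact hg
  · gcongr
    exact hg

theorem costate_bounds (h : IsStrongSolution Λ B C T q r d s u lam) (hT : 0 ≤ T) (hL : 0 ≤ L)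
    (hα : 0 < α) (hC : ‖C‖ ≤ L) {K : X →L[ℝ] U} (hK : ‖K‖ ≤ L)
    (hstab : ∀ t : ℝ, 0 ≤ t →
      ‖NormedSpace.exp (t • (Λ - B ∘L K))‖ ≤ L * Real.exp (-α * t)) :
    l2norm (volume.restrict (Icc 0 T)) lam ≤
        L / α * (L * l2norm (volume.restrict (Icc 0 T)) u
          + L * l2norm (volume.restrict (Icc 0 T)) r
          + L * l2norm (volume.restrict (Icc 0 T)) (fun t => C (s t))
          + l2norm (volume.restrict (Icc 0 T)) q)
        + L / √(2 * α) * ‖lam T‖ ∧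
      ‖lam 0‖ ≤ L * ‖lam T‖ + L / √(2 * α) *
        (L * l2norm (volume.restrict (Icc 0 T)) u + L * l2norm (volume.restrict (Icc 0 T)) r
          + L * l2norm (volume.restrict (Icc 0 T)) (fun t => C (s t))
          + l2norm (volume.restrict (Icc 0 T)) q) := by
  have hCs : MemLp (fun t => C (s t)) 2 (volume.restrict (Icc 0 T)) :=
    C.comp_memLp' (h.memLp_s hT)
  have hK' : ‖adjoint K‖ ≤ L := by rwa [LinearIsometryEquiv.norm_map]
  have hC' : ‖adjoint C‖ ≤ L := by rwa [LinearIsometryEquiv.norm_map]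
  have m1 : MemLp (fun t => adjoint K (u t)) 2 (volume.restrict (Icc 0 T)) :=
    (adjoint K).comp_memLp' h.memLp_u
  have m2 : MemLp (fun t => adjoint K (r t)) 2 (volume.restrict (Icc 0 T)) :=
    (adjoint K).comp_memLp' h.memLp_r
  have m3 : MemLp (fun t => adjoint C (C (s t))) 2 (volume.restrict (Icc 0 T)) :=
    (adjoint C).comp_memLp' hCs
  have m12 : MemLp (fun t => adjoint K (u t) - adjoint K (r t)) 2
    (volume.restrict (Icc 0 T)) := m1.sub m2
  have m123 : MemLp (fun t => adjoint K (u t) - adjoint K (r t) - adjoint C (C (s t))) 2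
    (volume.restrict (Icc 0 T)) := m12.sub m3
  have mg : MemLp (fun t => adjoint K (u t) - adjoint K (r t) - adjoint C (C (s t)) + q t) 2
    (volume.restrict (Icc 0 T)) := m123.add h.memLp_q
  have hode : HasIntegralDeriv (fun t => lam (T - t))
      (fun t => adjoint (Λ - B ∘L K) (lam (T - t)) + (adjoint K (u (T - t))
        - adjoint K (r (T - t)) - adjoint C (C (s (T - t))) + q (T - t))) T := by
    refine (h.costate.reflect hT).congr hT (fun _ _ => rfl) ?_
    filter_upwards [(measurePreserving_reflect T).quasiMeasurePreserving.ae h.control] with t ht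
    simp only [ht, map_sub, map_add, sub_apply,
      ContinuousLinearMap.adjoint_comp, ContinuousLinearMap.comp_apply, neg_neg]
    abel
  have hg := (l2norm_add_le m123 h.memLp_q).trans (add_le_add_left ((l2norm_sub_le m12 m3).trans
    (add_le_add ((l2norm_sub_le m1 m2).trans (add_le_add (l2norm_clm_le _ hK' h.memLp_u)
      (l2norm_clm_le _ hK' h.memLp_r))) (l2norm_clm_le _ hC' hCs))) _)
  obtain ⟨b1, b2⟩ := stable_bounds hT hL hα
    (fun t ht => (norm_exp_smul_adjoint _ t).trans_le (hstab t ht))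
    (mg.comp_measurePreserving (measurePreserving_reflect T)) hode
  have e1 := l2norm_reflect (h.memLp_lam hT)
  have e2 := l2norm_reflect mg
  simp only [sub_zero, sub_self, e1] at b1 b2
  change _ ≤ L / α * l2norm _ (fun t => adjoint K (u (T - t))
        - adjoint K (r (T - t)) - adjoint C (C (s (T - t))) + q (T - t)) + _ at b1
  change _ ≤ L * _ + L / √(2 * α) * l2norm _ (fun t => adjoint K (u (T - t))
        - adjoint K (r (T - t)) - adjoint C (C (s (T - t))) + q (T - t)) at b2
  rw [e2] at b1 b2
  refine ⟨b1.trans ?_, b2.trans ?_⟩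
  · gcongr
  · gcongr

theorem energy_bound (h : IsStrongSolution Λ B C T q r d s u lam) (hT : 0 ≤ T) :
    l2norm (volume.restrict (Icc 0 T)) (fun t => C (s t)) ^ 2
        + l2norm (volume.restrict (Icc 0 T)) u ^ 2 ≤
      ‖lam T‖ * ‖s T‖ + ‖lam 0‖ * ‖s 0‖
        + (l2norm (volume.restrict (Icc 0 T)) q * l2norm (volume.restrict (Icc 0 T)) s
          + l2norm (volume.restrict (Icc 0 T)) r * l2norm (volume.restrict (Icc 0 T)) u
          + l2norm (volume.restrict (Icc 0 T)) d * l2norm (volume.restrict (Icc 0 T)) lam) := by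
  have ms := h.memLp_s hT
  have ml := h.memLp_lam hT
  have mC : MemLp (fun t => C (s t)) 2 (volume.restrict (Icc 0 T)) := C.comp_memLp' ms
  have hP : HasIntegralDeriv (fun t => ⟪lam t, s t⟫_ℝ)
      (fun t => ⟪lam t, Λ (s t) + (B (u t) + d t)⟫_ℝ
        + ⟪-(adjoint Λ (lam t) + (q t - adjoint C (C (s t)))), s t⟫_ℝ) T :=
    h.costate.bilinear (innerSL ℝ) h.state hT
  have hsq := hP.eq_add T ⟨hT, le_rfl⟩
  rw [intervalIntegral.integral_of_le hT, ← integral_Icc_eq_integral_Ioc] at hsq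
  have iP := (intervalIntegrable_iff_integrableOn_Icc_of_le hT).1 hP.integrable
  have i1 := integrable_norm_mul_norm h.memLp_q ms
  have i2 := integrable_norm_mul_norm h.memLp_r h.memLp_u
  have i3 := integrable_norm_mul_norm h.memLp_d ml
  have i123 : Integrable (fun t => ‖q t‖ * ‖s t‖ + ‖r t‖ * ‖u t‖ + ‖d t‖ * ‖lam t‖)
    (volume.restrict (Icc 0 T)) := (i1.add i2).add i3
  have j1 := mC.norm.integrable_sq
  have j2 := h.memLp_u.norm.integrable_sq
  have key : ∫ t in Icc 0 T, (‖C (s t)‖ ^ 2 + ‖u t‖ ^ 2) ≤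
      ∫ t in Icc 0 T, ((⟪lam t, Λ (s t) + (B (u t) + d t)⟫_ℝ
        + ⟪-(adjoint Λ (lam t) + (q t - adjoint C (C (s t)))), s t⟫_ℝ)
        + (‖q t‖ * ‖s t‖ + ‖r t‖ * ‖u t‖ + ‖d t‖ * ‖lam t‖)) := by
    refine integral_mono_ae (j1.add j2) (iP.add i123) ?_
    filter_upwards [h.control] with t ht
    have e1 : ⟪lam t, Λ (s t) + (B (u t) + d t)⟫_ℝ
        + ⟪-(adjoint Λ (lam t) + (q t - adjoint C (C (s t)))), s t⟫_ℝ =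
        ‖C (s t)‖ ^ 2 + ‖u t‖ ^ 2 - ⟪r t, u t⟫_ℝ + ⟪d t, lam t⟫_ℝ - ⟪q t, s t⟫_ℝ := by
      have e2 : ⟪lam t, B (u t)⟫_ℝ = ⟪u t, u t⟫_ℝ - ⟪r t, u t⟫_ℝ := by
        rw [← ContinuousLinearMap.adjoint_inner_left, ← inner_sub_left]
        congr 1
        rw [eq_sub_iff_add_eq, add_comm]
        exact ht.symm
      simp only [inner_add_right, inner_neg_left, inner_add_left, inner_sub_left,
        ContinuousLinearMap.adjoint_inner_left, e2, real_inner_self_eq_norm_sq,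
        real_inner_comm (lam t) (d t)]
      ring
    simp only [e1]
    have f1 := neg_le_of_abs_le (abs_real_inner_le_norm (q t) (s t))
    have f2 := real_inner_le_norm (q t) (s t)
    have f3 := real_inner_le_norm (r t) (u t)
    have f4 := neg_le_of_abs_le (abs_real_inner_le_norm (d t) (lam t))
    linarith
  rw [integral_add j1 j2, integral_add iP i123,
    integral_add (f := fun t => ‖q t‖ * ‖s t‖ + ‖r t‖ * ‖u t‖) (i1.add i2) i3, integral_add i1 i2,
    ← l2norm_sq mC, ← l2norm_sq h.memLp_u] at key
  have k1 := integral_norm_mul_norm_le h.memLp_q ms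
  have k2 := integral_norm_mul_norm_le h.memLp_r h.memLp_u
  have k3 := integral_norm_mul_norm_le h.memLp_d ml
  have b1 := real_inner_le_norm (lam T) (s T)
  have b2 := neg_le_of_abs_le (abs_real_inner_le_norm (lam 0) (s 0))
  linarith

/-- Multiplication of a solution with a scalar weight. -/
theorem weighted (h : IsStrongSolution Λ B C T q r d s u lam) (hT : 0 ≤ T) {w ρ : ℝ → ℝ} {m : ℝ}
    (hw : HasIntegralDeriv w (fun t => ρ t * w t) T)
    (hρ : AEStronglyMeasurable ρ (volume.restrict (Icc 0 T))) (hρm : ∀ t, ‖ρ t‖ ≤ m) :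
    IsStrongSolution Λ B C T (fun t => w t • q t - ρ t • w t • lam t) (fun t => w t • r t)
      (fun t => w t • d t + ρ t • w t • s t) (fun t => w t • s t) (fun t => w t • u t)
      (fun t => w t • lam t) := by
  have hwc := hw.continuousOn hT
  have mρ : ∀ {f : ℝ → X}, MemLp f 2 (volume.restrict (Icc 0 T)) →
      MemLp (fun t => ρ t • w t • f t) 2 (volume.restrict (Icc 0 T)) := by
    intro f hf
    have h1 := memLp_smul_of_continuousOn hwc hf
    refine h1.of_le_mul (c := m) (hρ.smul h1.aestronglyMeasurable) ?_
    refine Filter.Eventually.of_forall fun t => ?_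
    rw [norm_smul]
    gcongr
    exact hρm t
  refine ⟨(memLp_smul_of_continuousOn hwc h.memLp_q).sub (mρ (h.memLp_lam hT)),
    memLp_smul_of_continuousOn hwc h.memLp_r,
    (memLp_smul_of_continuousOn hwc h.memLp_d).add (mρ (h.memLp_s hT)),
    memLp_smul_of_continuousOn hwc h.memLp_u, ?_, ?_, ?_⟩
  · refine (hw.bilinear (ContinuousLinearMap.lsmul ℝ ℝ) h.state hT).congr hT (fun _ _ => rfl)
      (Filter.Eventually.of_forall fun t => ?_)
    simp only [ContinuousLinearMap.lsmul_apply, map_smul, smul_add, mul_smul]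
    abel
  · refine (hw.bilinear (ContinuousLinearMap.lsmul ℝ ℝ) h.costate hT).congr hT (fun _ _ => rfl)
      (Filter.Eventually.of_forall fun t => ?_)
    simp only [ContinuousLinearMap.lsmul_apply, map_smul, smul_add, smul_sub, smul_neg, mul_smul]
    abel
  · filter_upwards [h.control] with t ht
    rw [ht, smul_add, map_smul]

/-- The weighted a priori estimate. -/
theorem weighted_bound (h : IsStrongSolution Λ B C T q r d s u lam) (hT : 0 ≤ T) (hL : 1 ≤ L)
    (hα : 0 < α) (hαL : α ≤ L * (1 + L)) (hB : ‖B‖ ≤ L) (hC : ‖C‖ ≤ L)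
    {K : X →L[ℝ] U} (hK : ‖K‖ ≤ L)
    (hstab : ∀ t : ℝ, 0 ≤ t →
      ‖NormedSpace.exp (t • (Λ - B ∘L K))‖ ≤ L * Real.exp (-α * t))
    {K' : Y →L[ℝ] X} (hK' : ‖K'‖ ≤ L)
    (hdet : ∀ t : ℝ, 0 ≤ t →
      ‖NormedSpace.exp (t • (Λ - K' ∘L C))‖ ≤ L * Real.exp (-α * t))
    {w ρ : ℝ → ℝ} (hw : HasIntegralDeriv w (fun t => ρ t * w t) T)
    (hρ : AEStronglyMeasurable ρ (volume.restrict (Icc 0 T)))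
    (hρm : ∀ t, ‖ρ t‖ ≤ 1 / (4 * dTilde L α)) :
    √(l2norm (volume.restrict (Icc 0 T)) (fun t => w t • s t) ^ 2
      + l2norm (volume.restrict (Icc 0 T)) (fun t => w t • u t) ^ 2
      + l2norm (volume.restrict (Icc 0 T)) (fun t => w t • lam t) ^ 2) ≤
    8 * dTilde L α *
      (√(l2norm (volume.restrict (Icc 0 T)) (fun t => w t • q t) ^ 2
        + l2norm (volume.restrict (Icc 0 T)) (fun t => w t • r t) ^ 2
        + l2norm (volume.restrict (Icc 0 T)) (fun t => w t • d t) ^ 2)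
        + (‖w 0 • s 0‖ + ‖w T • lam T‖)) := by
  have hD := dTilde_pos hL hα
  have hL0 : 0 ≤ L := by linarith
  have hwc := hw.continuousOn hT
  have hm0 : 0 ≤ 1 / (4 * dTilde L α) := by positivity
  have H := h.weighted hT hw hρ hρm
  obtain ⟨h1, h2⟩ := H.state_bounds hT hL0 hα hB hK' hdet
  obtain ⟨h3, h4⟩ := H.costate_bounds hT hL0 hα hC hK hstab
  have h5 := H.energy_bound hT
  have ms := H.memLp_s hT
  have ml := H.memLp_lam hT
  have mρ : ∀ {f : ℝ → X}, MemLp f 2 (volume.restrict (Icc 0 T)) →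
      l2norm (volume.restrict (Icc 0 T)) (fun t => ρ t • f t) ≤
        1 / (4 * dTilde L α) * l2norm (volume.restrict (Icc 0 T)) f ∧
      MemLp (fun t => ρ t • f t) 2 (volume.restrict (Icc 0 T)) := by
    intro f hf
    have hb : ∀ t, ‖ρ t • f t‖ ≤ 1 / (4 * dTilde L α) * ‖f t‖ := fun t => by
      rw [norm_smul]
      gcongr
      exact hρm t
    exact ⟨l2norm_le_mul hm0 hf (Filter.Eventually.of_forall hb),
      hf.of_le_mul (hρ.smul hf.aestronglyMeasurable) (Filter.Eventually.of_forall hb)⟩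
  have n1 := (l2norm_sub_le (memLp_smul_of_continuousOn hwc h.memLp_q) (mρ ml).2).trans
    (add_le_add_right (mρ ml).1 _)
  have n3 := (l2norm_add_le (memLp_smul_of_continuousOn hwc h.memLp_d) (mρ ms).2).trans
    (add_le_add_right (mρ ms).1 _)
  refine solution_norm_le hL hα hαL (l2norm_nonneg _) (l2norm_nonneg _) (l2norm_nonneg _)
    (norm_nonneg _) (norm_nonneg _) (Real.sqrt_nonneg _) h1 h2 h3 h4 h5 ?_
  refine (sqrt_sum_sq_mono (l2norm_nonneg _) (l2norm_nonneg _) (l2norm_nonneg _) n1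
    (add_zero _).ge n3).trans ((sqrt_sum_sq_add_le _ _ _ _ _ _).trans (add_le_add_right ?_ _))
  refine Real.sqrt_le_iff.2 ⟨by positivity, ?_⟩
  rw [div_pow, Real.sq_sqrt (by positivity), mul_pow, mul_pow, div_pow, one_pow]
  have : 0 ≤ 1 / (4 * dTilde L α) ^ 2 *
    l2norm (volume.restrict (Icc 0 T)) (fun t => w t • u t) ^ 2 := by positivity
  rw [div_eq_mul_one_div (_ + _ + _)]
  linarith

end IsStrongSolution

end StrongSolution

section Weight

theorem abs_exp_sub_exp_le {a b M : ℝ} (ha : a ≤ M) (hb : b ≤ M) :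
    |Real.exp a - Real.exp b| ≤ Real.exp M * |a - b| := by
  have key : ∀ {x y : ℝ}, x ≤ M → Real.exp x - Real.exp y ≤ Real.exp M * |x - y| := by
    intro x y hx
    have h1 : Real.exp y = Real.exp x * Real.exp (y - x) := by rw [← Real.exp_add]; simp
    have h2 := Real.add_one_le_exp (y - x)
    calc Real.exp x - Real.exp y ≤ Real.exp x * (x - y) := by
          rw [h1]
          have := mul_le_mul_of_nonneg_left h2 (Real.exp_pos x).le
          linarith
      _ ≤ Real.exp x * |x - y| := by gcongr; exact le_abs_self _
      _ ≤ _ := by gcongr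
  refine abs_le.2 ⟨?_, key ha⟩
  have := key (y := a) hb
  rw [abs_sub_comm] at this
  linarith

theorem hasIntegralDeriv_exp_infDist (S : Set ℝ) {m T : ℝ} (hm : 0 ≤ m) (hT : 0 ≤ T) :
    HasIntegralDeriv (fun t => Real.exp (m * Metric.infDist t S))
      (fun t => m * deriv (fun x => Metric.infDist x S) t *
        Real.exp (m * Metric.infDist t S)) T := by
  have hc : Continuous fun t => Metric.infDist t S := Metric.continuous_infDist_pt S
  have hlip : LipschitzWith 1 fun t => Metric.infDist t S := Metric.lipschitz_infDist_pt S
  obtain ⟨M, hM⟩ := isCompact_Icc.exists_bound_of_continuousOn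
    ((hc.const_mul m).continuousOn (s := Icc 0 T))
  refine .of_ae_hasDerivAt hT ?_ ?_ ?_
  · refine LipschitzOnWith.absolutelyContinuousOnInterval
      (K := NNReal.mk (Real.exp M * m) (by positivity)) (LipschitzOnWith.of_dist_le_mul ?_)
    rw [uIcc_of_le hT]
    intro x hx y hy
    refine (abs_exp_sub_exp_le ((le_abs_self _).trans (hM x hx))
      ((le_abs_self _).trans (hM y hy))).trans ?_
    rw [NNReal.coe_mk, ← mul_sub, abs_mul, abs_of_nonneg hm, ← mul_assoc]
    gcongr
    simpa [Real.dist_eq] using hlip.dist_le_mul x y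
  · rw [intervalIntegrable_iff_integrableOn_Icc_of_le hT]
    refine Integrable.mono' (g := fun _ => m * 1 * Real.exp M) (integrable_const _) ?_ ?_
    · exact (((measurable_deriv _).const_mul m).mul
        (Real.measurable_exp.comp (hc.measurable.const_mul m))).aestronglyMeasurable
    · filter_upwards [ae_restrict_mem measurableSet_Icc] with t ht
      rw [norm_mul, norm_mul, Real.norm_of_nonneg hm, Real.norm_of_nonneg (Real.exp_pos _).le]
      gcongr
      · simpa using norm_deriv_le_of_lipschitz (x₀ := t) hlip
      · exact (le_abs_self _).trans (hM t ht)
  · filter_upwards [hlip.ae_differentiableAt_real] with t ht _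
    have := (ht.hasDerivAt.const_mul m).exp
    rwa [mul_comm]

end Weight

section Matrices

variable {k l m n : ℕ}

/-- The continuous linear map between Euclidean spaces given by a matrix. -/
noncomputable def matrixCLM (A : Matrix (Fin m) (Fin n) ℝ) : Vec n →L[ℝ] Vec m :=
  (Matrix.toEuclideanLin A).toContinuousLinearMap

theorem toEuclideanLin_eq_matrixCLM (A : Matrix (Fin m) (Fin n) ℝ) (x : Vec n) :
    Matrix.toEuclideanLin A x = matrixCLM A x := rfl

theorem norm_matrixCLM (A : Matrix (Fin m) (Fin n) ℝ) : ‖matrixCLM A‖ = ‖A‖ := rfl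

theorem matrixCLM_mul (A : Matrix (Fin l) (Fin m) ℝ) (B : Matrix (Fin m) (Fin n) ℝ) :
    matrixCLM (A * B) = matrixCLM A ∘L matrixCLM B := by
  ext x : 1
  exact DFunLike.congr_fun (Matrix.toLpLin_mul 2 2 2 A B) x

theorem matrixCLM_sub (A B : Matrix (Fin m) (Fin n) ℝ) :
    matrixCLM (A - B) = matrixCLM A - matrixCLM B := by
  ext x : 1
  exact DFunLike.congr_fun (map_sub Matrix.toEuclideanLin A B) x

theorem matrixCLM_transpose (A : Matrix (Fin m) (Fin n) ℝ) :
    matrixCLM Aᵀ = adjoint (matrixCLM A) := by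
  ext x : 1
  rw [← Matrix.conjTranspose_eq_transpose_of_trivial]
  exact DFunLike.congr_fun (Matrix.toEuclideanLin_conjTranspose_eq_adjoint A) x

theorem matrixCLM_exp (t : ℝ) (A : Matrix (Fin n) (Fin n) ℝ) :
    matrixCLM (NormedSpace.exp (t • A)) = NormedSpace.exp (t • matrixCLM A) := by
  have hc : Continuous (Matrix.toEuclideanCLM (𝕜 := ℝ) (n := Fin n)) :=
    AddMonoidHomClass.continuous_of_bound _ 1 fun x => by
      rw [Matrix.l2_opNorm_toEuclideanCLM, one_mul]
  have h := NormedSpace.map_exp_of_mem_ball (𝕂 := ℝ)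
    (Matrix.toEuclideanCLM (𝕜 := ℝ) (n := Fin n)) hc (t • A)
    (by simp [NormedSpace.expSeries_radius_eq_top])
  rw [map_smul] at h
  exact h

end Matrices

section Components

variable {ns nu : ℕ}

theorem norm_sq_eq_components (z : Triple ns nu) :
    ‖z‖ ^ 2 = ‖comp₁ z‖ ^ 2 + ‖comp₂ z‖ ^ 2 + ‖comp₃ z‖ ^ 2 := by
  rw [WithLp.prod_norm_sq_eq_of_L2, WithLp.prod_norm_sq_eq_of_L2, add_assoc]
  rfl

/-- `comp₁` as a continuous linear map. -/
noncomputable def comp₁L : Triple ns nu →L[ℝ] Vec ns := WithLp.fstL 2 ℝ _ _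

/-- `comp₂` as a continuous linear map. -/
noncomputable def comp₂L : Triple ns nu →L[ℝ] Vec nu := WithLp.fstL 2 ℝ _ _ ∘L WithLp.sndL 2 ℝ _ _

/-- `comp₃` as a continuous linear map. -/
noncomputable def comp₃L : Triple ns nu →L[ℝ] Vec ns := WithLp.sndL 2 ℝ _ _ ∘L WithLp.sndL 2 ℝ _ _

theorem comp₁L_apply (z : Triple ns nu) : comp₁L z = comp₁ z := rfl

theorem comp₂L_apply (z : Triple ns nu) : comp₂L z = comp₂ z := rfl

theorem comp₃L_apply (z : Triple ns nu) : comp₃L z = comp₃ z := rfl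

theorem l2norm_sq_eq_components {Ω : Type*} [MeasurableSpace Ω] {μ : Measure Ω}
    {z : Ω → Triple ns nu} (hz : MemLp z 2 μ) :
    l2norm μ z ^ 2 = l2norm μ (fun t => comp₁ (z t)) ^ 2 + l2norm μ (fun t => comp₂ (z t)) ^ 2
      + l2norm μ (fun t => comp₃ (z t)) ^ 2 := by
  have m1 : MemLp (fun t => comp₁ (z t)) 2 μ := comp₁L.comp_memLp' hz
  have m2 : MemLp (fun t => comp₂ (z t)) 2 μ := comp₂L.comp_memLp' hz
  have m3 : MemLp (fun t => comp₃ (z t)) 2 μ := comp₃L.comp_memLp' hz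
  rw [l2norm_sq hz, l2norm_sq m1, l2norm_sq m2, l2norm_sq m3,
    ← integral_add m1.norm.integrable_sq m2.norm.integrable_sq,
    ← integral_add (f := fun t => ‖comp₁ (z t)‖ ^ 2 + ‖comp₂ (z t)‖ ^ 2)
      (m1.norm.integrable_sq.add m2.norm.integrable_sq) m3.norm.integrable_sq]
  exact integral_congr_ae (Filter.Eventually.of_forall fun t => norm_sq_eq_components (z t))

end Components

section MildSolution

variable {ns nu ny : ℕ} {Λ : Matrix (Fin ns) (Fin ns) ℝ} {B : Matrix (Fin ns) (Fin nu) ℝ}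
  {C : Matrix (Fin ny) (Fin ns) ℝ} {T : ℝ}

/-- A mild solution agrees almost everywhere with a strong one. -/
theorem IsMildSolution.exists_isStrongSolution (hT : 0 ≤ T) {p z : ℝ → Triple ns nu}
    {sbar lbar : Vec ns} (hp : MemLp p 2 (volume.restrict (Icc 0 T)))
    (hz : MemLp z 2 (volume.restrict (Icc 0 T)))
    (h : IsMildSolution Λ B C T p sbar lbar z) :
    ∃ s lam : ℝ → Vec ns,
      IsStrongSolution (matrixCLM Λ) (matrixCLM B) (matrixCLM C) T (fun t => comp₁ (p t))
        (fun t => comp₂ (p t)) (fun t => comp₃ (p t)) s (fun t => comp₂ (z t)) lam ∧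
      (∀ᵐ t ∂(volume.restrict (Icc 0 T)), comp₁ (z t) = s t) ∧
      (∀ᵐ t ∂(volume.restrict (Icc 0 T)), comp₃ (z t) = lam t) ∧
      s 0 = sbar ∧ lam T = lbar := by
  have mq : MemLp (fun t => comp₁ (p t)) 2 (volume.restrict (Icc 0 T)) := comp₁L.comp_memLp' hp
  have mr : MemLp (fun t => comp₂ (p t)) 2 (volume.restrict (Icc 0 T)) := comp₂L.comp_memLp' hp
  have md : MemLp (fun t => comp₃ (p t)) 2 (volume.restrict (Icc 0 T)) := comp₃L.comp_memLp' hp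
  have ms : MemLp (fun t => comp₁ (z t)) 2 (volume.restrict (Icc 0 T)) := comp₁L.comp_memLp' hz
  have mu : MemLp (fun t => comp₂ (z t)) 2 (volume.restrict (Icc 0 T)) := comp₂L.comp_memLp' hz
  let f : ℝ → Vec ns := fun t => matrixCLM B (comp₂ (z t)) + comp₃ (p t)
  let g : ℝ → Vec ns := fun t =>
    comp₁ (p t) - adjoint (matrixCLM C) (matrixCLM C (comp₁ (z t)))
  have mf : MemLp f 2 (volume.restrict (Icc 0 T)) := ((matrixCLM B).comp_memLp' mu).add md
  have mg : MemLp g 2 (volume.restrict (Icc 0 T)) :=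
    mq.sub ((adjoint (matrixCLM C)).comp_memLp' ((matrixCLM C).comp_memLp' ms))
  have hf : IntervalIntegrable f volume 0 T :=
    (intervalIntegrable_iff_integrableOn_Icc_of_le hT).2 (mf.integrable (by norm_num))
  have hg : IntervalIntegrable (fun t => g (T - t)) volume 0 T :=
    (intervalIntegrable_iff_integrableOn_Icc_of_le hT).2
      ((mg.comp_measurePreserving (measurePreserving_reflect T)).integrable (by norm_num))
  let s : ℝ → Vec ns := fun t => NormedSpace.exp (t • matrixCLM Λ) sbar
    + ∫ τ in (0 : ℝ)..t, NormedSpace.exp ((t - τ) • matrixCLM Λ) (f τ)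
  let κ : ℝ → Vec ns := fun t => NormedSpace.exp (t • adjoint (matrixCLM Λ)) lbar
    + ∫ τ in (0 : ℝ)..t, NormedSpace.exp ((t - τ) • adjoint (matrixCLM Λ)) (g (T - τ))
  have hs := hasIntegralDeriv_of_eq_mild (s := s) hT (matrixCLM Λ) hf (fun t _ => rfl)
  have hκ := hasIntegralDeriv_of_eq_mild (s := κ) hT (adjoint (matrixCLM Λ)) hg (fun t _ => rfl)
  have hκ' : ∀ t, κ (T - t) = (∫ τ in t..T,
      NormedSpace.exp ((τ - t) • adjoint (matrixCLM Λ)) (g τ))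
      + NormedSpace.exp ((T - t) • adjoint (matrixCLM Λ)) lbar := by
    intro t
    have := intervalIntegral.integral_comp_sub_left (a := 0) (b := T - t)
      (fun τ => NormedSpace.exp ((τ - t) • adjoint (matrixCLM Λ)) (g τ)) T
    rw [sub_sub_cancel, sub_zero] at this
    rw [← this, add_comm]
    simp only [κ, sub_right_comm T t]
  have h1 : ∀ᵐ t ∂(volume.restrict (Icc 0 T)), comp₁ (z t) = s t := by
    filter_upwards [h] with t ht
    rw [ht.2.2]
    simp only [toEuclideanLin_eq_matrixCLM, matrixCLM_exp, s, f]
  have h3 : ∀ᵐ t ∂(volume.restrict (Icc 0 T)), comp₃ (z t) = κ (T - t) := by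
    filter_upwards [h] with t ht
    rw [ht.1, hκ' t]
    simp only [toEuclideanLin_eq_matrixCLM, matrixCLM_exp, matrixCLM_transpose, matrixCLM_mul,
      ContinuousLinearMap.comp_apply, g]
  refine ⟨s, fun t => κ (T - t), ⟨mq, mr, md, mu, ?_, ?_, ?_⟩, h1, h3, ?_, ?_⟩
  · exact hs
  · refine (hκ.reflect hT).congr hT (fun _ _ => rfl) ?_
    filter_upwards [h1] with t ht
    simp only [sub_sub_cancel, g, ht]
  · filter_upwards [h, h3] with t ht ht3
    have := ht.2.1
    rw [toEuclideanLin_eq_matrixCLM, matrixCLM_transpose, ht3] at this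
    rw [← sub_eq_zero, ← neg_eq_zero, this]
    abel
  · simp [s, exp_zero_smul_apply]
  · simp [κ]

end MildSolution

theorem setDist_le_infDist {I S : Set ℝ} {t : ℝ} (ht : t ∈ I) :
    setDist I S ≤ Metric.infDist t S := by
  rcases S.eq_empty_or_nonempty with rfl | hS
  · simp [setDist]
  · refine (Metric.le_infDist hS).2 fun y hy => ?_
    exact csInf_le ⟨0, by rintro r ⟨x, -, y, -, rfl⟩; positivity⟩ ⟨t, ht, y, hy, Real.dist_eq t y⟩

theorem sqrt_setIntegral_norm_sq {E : Type*} [NormedAddCommGroup E] {I : Set ℝ} {f : ℝ → E}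
    (hf : MemLp f 2 (volume.restrict I)) :
    √(∫ t in I, ‖f t‖ ^ 2) = l2norm (volume.restrict I) f := by
  rw [← l2norm_sq hf, Real.sqrt_sq (l2norm_nonneg _)]

section Decay

variable {ns nu ny : ℕ} {Λ : Matrix (Fin ns) (Fin ns) ℝ} {B : Matrix (Fin ns) (Fin nu) ℝ}
  {C : Matrix (Fin ny) (Fin ns) ℝ} {T L α : ℝ}

theorem IsStable.norm_exp_matrixCLM_le {Φ : Matrix (Fin ns) (Fin ns) ℝ} (h : IsStable L α Φ)
    {t : ℝ} (ht : 0 ≤ t) : ‖NormedSpace.exp (t • matrixCLM Φ)‖ ≤ L * Real.exp (-α * t) := by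
  rw [← matrixCLM_exp, norm_matrixCLM]
  exact h t ht

theorem IsStabilizable.le_mul_one_add (hns : 0 < ns) (hL : 1 ≤ L) (hΛL : ‖Λ‖ ≤ L) (hBL : ‖B‖ ≤ L)
    (hstab : IsStabilizable L α Λ B) : α ≤ L * (1 + L) := by
  obtain ⟨K, hK, hst⟩ := hstab
  have : Nonempty (Fin ns) := ⟨⟨0, hns⟩⟩
  have hL0 : 0 < L := by linarith
  refine (le_norm_of_stable hL0 fun t ht => hst.norm_exp_matrixCLM_le ht).trans ?_
  rw [norm_matrixCLM]
  calc ‖Λ - B * K‖ ≤ ‖Λ‖ + ‖B * K‖ := norm_sub_le _ _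
    _ ≤ ‖Λ‖ + ‖B‖ * ‖K‖ := by gcongr; exact Matrix.l2_opNorm_mul B K
    _ ≤ L + L * L := by gcongr
    _ = _ := by ring

/-- `IsStrongSolution.weighted_bound` for systems given by matrices. -/
theorem IsStrongSolution.weighted_bound_matrix (hns : 0 < ns) (hT : 0 ≤ T) (hL : 1 ≤ L)
    (hα : 0 < α) (hΛL : ‖Λ‖ ≤ L) (hBL : ‖B‖ ≤ L) (hCL : ‖C‖ ≤ L)
    (hstab : IsStabilizable L α Λ B) (hdet : IsDetectable L α Λ C)
    {q d s lam : ℝ → Vec ns} {r u : ℝ → Vec nu}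
    (h : IsStrongSolution (matrixCLM Λ) (matrixCLM B) (matrixCLM C) T q r d s u lam)
    {w ρ : ℝ → ℝ} (hw : HasIntegralDeriv w (fun t => ρ t * w t) T)
    (hρ : AEStronglyMeasurable ρ (volume.restrict (Icc 0 T)))
    (hρm : ∀ t, ‖ρ t‖ ≤ 1 / (4 * dTilde L α)) :
    √(l2norm (volume.restrict (Icc 0 T)) (fun t => w t • s t) ^ 2
      + l2norm (volume.restrict (Icc 0 T)) (fun t => w t • u t) ^ 2
      + l2norm (volume.restrict (Icc 0 T)) (fun t => w t • lam t) ^ 2) ≤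
    8 * dTilde L α *
      (√(l2norm (volume.restrict (Icc 0 T)) (fun t => w t • q t) ^ 2
        + l2norm (volume.restrict (Icc 0 T)) (fun t => w t • r t) ^ 2
        + l2norm (volume.restrict (Icc 0 T)) (fun t => w t • d t) ^ 2)
        + (‖w 0 • s 0‖ + ‖w T • lam T‖)) := by
  have hαL := hstab.le_mul_one_add hns hL hΛL hBL
  obtain ⟨K, hK, hst⟩ := hstab
  obtain ⟨K', hK', hdt⟩ := hdet
  refine h.weighted_bound hT hL hα hαL hBL hCL (K := matrixCLM K) hK (fun t ht => ?_)
    (K' := matrixCLM K') hK' (fun t ht => ?_) hw hρ hρm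
  · rw [← matrixCLM_mul, ← matrixCLM_sub]
    exact hst.norm_exp_matrixCLM_le ht
  · rw [← matrixCLM_mul, ← matrixCLM_sub]
    exact hdt.norm_exp_matrixCLM_le ht

/-- Decay of mild solutions away from a set `S`. -/
theorem IsMildSolution.decay (hns : 0 < ns) (hT : 0 ≤ T) (hL : 1 ≤ L)
    (hα : 0 < α) (hΛL : ‖Λ‖ ≤ L) (hBL : ‖B‖ ≤ L) (hCL : ‖C‖ ≤ L)
    (hstab : IsStabilizable L α Λ B) (hdet : IsDetectable L α Λ C)
    {p z : ℝ → Triple ns nu} {sbar lbar : Vec ns}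
    (hp : MemLp p 2 (volume.restrict (Icc 0 T))) (hz : MemLp z 2 (volume.restrict (Icc 0 T)))
    (h : IsMildSolution Λ B C T p sbar lbar z) {I : Set ℝ} (hI : MeasurableSet I)
    (hIT : I ⊆ Icc 0 T) (S : Set ℝ) :
    l2norm (volume.restrict I) z ≤ 8 * dTilde L α *
      (Real.exp (-setDist I S / (4 * dTilde L α)) *
        (l2norm (volume.restrict (Icc 0 T))
            (fun t => Real.exp (1 / (4 * dTilde L α) * Metric.infDist t S) • p t)
          + (Real.exp (1 / (4 * dTilde L α) * Metric.infDist 0 S) * ‖sbar‖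
            + Real.exp (1 / (4 * dTilde L α) * Metric.infDist T S) * ‖lbar‖))) := by
  have hD := dTilde_pos hL hα
  have hm : 0 ≤ 1 / (4 * dTilde L α) := by positivity
  obtain ⟨s, lam, hs, h1, h3, rfl, rfl⟩ := h.exists_isStrongSolution hT hp hz
  set m := 1 / (4 * dTilde L α) with hmdef
  let w : ℝ → ℝ := fun t => Real.exp (m * Metric.infDist t S)
  have hwd : HasIntegralDeriv w _ T := hasIntegralDeriv_exp_infDist S hm hT
  have hwc := hwd.continuousOn hT
  have hw0 : ∀ t, 0 < w t := fun t => Real.exp_pos _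
  have hb := hs.weighted_bound_matrix hns hT hL hα hΛL hBL hCL hstab hdet hwd
    ((measurable_deriv _).const_mul m).aestronglyMeasurable (fun t => by
      rw [norm_mul, Real.norm_of_nonneg hm]
      refine mul_le_of_le_one_right hm ?_
      simpa using norm_deriv_le_of_lipschitz (x₀ := t) (Metric.lipschitz_infDist_pt S))
  have hwz := memLp_smul_of_continuousOn hwc hz
  have hwp := memLp_smul_of_continuousOn hwc hp
  have ez : √(l2norm (volume.restrict (Icc 0 T)) (fun t => w t • s t) ^ 2
      + l2norm (volume.restrict (Icc 0 T)) (fun t => w t • comp₂ (z t)) ^ 2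
      + l2norm (volume.restrict (Icc 0 T)) (fun t => w t • lam t) ^ 2) =
      l2norm (volume.restrict (Icc 0 T)) (fun t => w t • z t) := by
    rw [← Real.sqrt_sq (l2norm_nonneg (fun t => w t • z t)), l2norm_sq_eq_components hwz]
    have e1 : l2norm (volume.restrict (Icc 0 T)) (fun t => w t • s t) =
        l2norm (volume.restrict (Icc 0 T)) (fun t => comp₁ (w t • z t)) := by
      refine l2norm_congr ?_
      filter_upwards [h1] with t ht
      rw [← ht]; rfl
    have e3 : l2norm (volume.restrict (Icc 0 T)) (fun t => w t • lam t) =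
        l2norm (volume.restrict (Icc 0 T)) (fun t => comp₃ (w t • z t)) := by
      refine l2norm_congr ?_
      filter_upwards [h3] with t ht
      rw [← ht]; rfl
    rw [e1, e3]
    rfl
  have ep : √(l2norm (volume.restrict (Icc 0 T)) (fun t => w t • comp₁ (p t)) ^ 2
      + l2norm (volume.restrict (Icc 0 T)) (fun t => w t • comp₂ (p t)) ^ 2
      + l2norm (volume.restrict (Icc 0 T)) (fun t => w t • comp₃ (p t)) ^ 2) =
      l2norm (volume.restrict (Icc 0 T)) (fun t => w t • p t) := by
    rw [← Real.sqrt_sq (l2norm_nonneg (fun t => w t • p t)), l2norm_sq_eq_components hwp]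
    rfl
  rw [ez, ep, norm_smul, norm_smul, Real.norm_of_nonneg (hw0 _).le,
    Real.norm_of_nonneg (hw0 _).le] at hb
  have hloc : l2norm (volume.restrict I) z ≤
      Real.exp (-setDist I S / (4 * dTilde L α)) *
        l2norm (volume.restrict I) (fun t => w t • z t) := by
    refine l2norm_le_mul (Real.exp_pos _).le (hwz.mono_measure (Measure.restrict_mono hIT le_rfl)) ?_
    filter_upwards [ae_restrict_mem hI] with t ht
    rw [norm_smul, Real.norm_of_nonneg (hw0 _).le, ← mul_assoc, ← Real.exp_add]
    refine le_mul_of_one_le_left (norm_nonneg _) (Real.one_le_exp ?_)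
    have := mul_le_mul_of_nonneg_left (setDist_le_infDist (S := S) ht) hm
    have e : -setDist I S / (4 * dTilde L α) = -(m * setDist I S) := by rw [hmdef]; ring
    rw [e]
    linarith
  have hmono : l2norm (volume.restrict I) (fun t => w t • z t) ≤
      l2norm (volume.restrict (Icc 0 T)) (fun t => w t • z t) :=
    ENNReal.toReal_mono hwz.eLpNorm_ne_top
      (eLpNorm_mono_measure _ (Measure.restrict_mono hIT le_rfl))
  calc _ ≤ Real.exp (-setDist I S / (4 * dTilde L α)) *
        (8 * dTilde L α * (l2norm (volume.restrict (Icc 0 T)) (fun t => w t • p t)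
          + (w 0 * ‖s 0‖ + w T * ‖lam T‖))) := by
        refine hloc.trans ?_
        gcongr
        exact hmono.trans hb
    _ = _ := by ring

/-- A strong solution with vanishing data vanishes. -/
theorem IsStrongSolution.ae_eq_zero (hns : 0 < ns) (hT : 0 ≤ T) (hL : 1 ≤ L)
    (hα : 0 < α) (hΛL : ‖Λ‖ ≤ L) (hBL : ‖B‖ ≤ L) (hCL : ‖C‖ ≤ L)
    (hstab : IsStabilizable L α Λ B) (hdet : IsDetectable L α Λ C)
    {s lam : ℝ → Vec ns} {u : ℝ → Vec nu}
    (h : IsStrongSolution (matrixCLM Λ) (matrixCLM B) (matrixCLM C) T 0 0 0 s u lam)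
    (hs : s 0 = 0) (hlam : lam T = 0) :
    (∀ᵐ t ∂(volume.restrict (Icc 0 T)), s t = 0) ∧
    (∀ᵐ t ∂(volume.restrict (Icc 0 T)), u t = 0) ∧
    (∀ᵐ t ∂(volume.restrict (Icc 0 T)), lam t = 0) := by
  have hD := dTilde_pos hL hα
  have hb := h.weighted_bound_matrix hns hT hL hα hΛL hBL hCL hstab hdet
    (w := fun _ => 1) (ρ := fun _ => 0)
    (HasIntegralDeriv.of_hasDerivAt (fun t => by simpa using hasDerivAt_const t (1 : ℝ))
      (by fun_prop)) aestronglyMeasurable_const (fun t => by rw [norm_zero]; positivity)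
  have z1 : ∀ {E : Type} [NormedAddCommGroup E],
      l2norm (volume.restrict (Icc 0 T)) (fun _ => (0 : E)) = 0 := by
    intro E _
    simp [l2norm]
  simp only [one_smul, hs, hlam, norm_zero, Pi.zero_apply, z1] at hb
  norm_num at hb
  have hsum := Real.sqrt_eq_zero'.1 (le_antisymm hb (Real.sqrt_nonneg _))
  have n1 := sq_nonneg (l2norm (volume.restrict (Icc 0 T)) s)
  have n2 := sq_nonneg (l2norm (volume.restrict (Icc 0 T)) u)
  have n3 := sq_nonneg (l2norm (volume.restrict (Icc 0 T)) lam)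
  refine ⟨(l2norm_eq_zero_iff (h.memLp_s hT)).1 ?_, (l2norm_eq_zero_iff h.memLp_u).1 ?_,
    (l2norm_eq_zero_iff (h.memLp_lam hT)).1 ?_⟩ <;>
  · rw [← sq_eq_zero_iff]
    linarith

/-- Superposition: a mild solution is the sum of the mild solutions for the parts of its data. -/
theorem IsMildSolution.ae_eq_sum (hns : 0 < ns) (hT : 0 ≤ T) (hL : 1 ≤ L)
    (hα : 0 < α) (hΛL : ‖Λ‖ ≤ L) (hBL : ‖B‖ ≤ L) (hCL : ‖C‖ ≤ L)
    (hstab : IsStabilizable L α Λ B) (hdet : IsDetectable L α Λ C)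
    {p z p₁ z₁ p₂ z₂ : ℝ → Triple ns nu} {sbar lbar sbar₁ lbar₁ sbar₂ lbar₂ : Vec ns}
    (hp : MemLp p 2 (volume.restrict (Icc 0 T))) (hz : MemLp z 2 (volume.restrict (Icc 0 T)))
    (h : IsMildSolution Λ B C T p sbar lbar z)
    (hp₁ : MemLp p₁ 2 (volume.restrict (Icc 0 T))) (hz₁ : MemLp z₁ 2 (volume.restrict (Icc 0 T)))
    (h₁ : IsMildSolution Λ B C T p₁ sbar₁ lbar₁ z₁)
    (hp₂ : MemLp p₂ 2 (volume.restrict (Icc 0 T))) (hz₂ : MemLp z₂ 2 (volume.restrict (Icc 0 T)))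
    (h₂ : IsMildSolution Λ B C T p₂ sbar₂ lbar₂ z₂)
    (hpsum : ∀ᵐ t ∂(volume.restrict (Icc 0 T)), p t = p₁ t + p₂ t)
    (hs : sbar = sbar₁ + sbar₂) (hl : lbar = lbar₁ + lbar₂) :
    ∀ᵐ t ∂(volume.restrict (Icc 0 T)), z t = z₁ t + z₂ t := by
  obtain ⟨s, l, k, a, b, rfl, rfl⟩ := h.exists_isStrongSolution hT hp hz
  obtain ⟨s₁, l₁, k₁, a₁, b₁, rfl, rfl⟩ := h₁.exists_isStrongSolution hT hp₁ hz₁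
  obtain ⟨s₂, l₂, k₂, a₂, b₂, rfl, rfl⟩ := h₂.exists_isStrongSolution hT hp₂ hz₂
  have hk := ((k.sub k₁).sub k₂).congr (q' := 0) (r' := 0) (d' := 0) hT
    (by
      filter_upwards [hpsum] with t ht
      rw [ht, ← comp₁L_apply, map_add]
      simp [comp₁L_apply])
    (by
      filter_upwards [hpsum] with t ht
      rw [ht, ← comp₂L_apply, map_add]
      simp [comp₂L_apply])
    (by
      filter_upwards [hpsum] with t ht
      rw [ht, ← comp₃L_apply, map_add]
      simp [comp₃L_apply])
  obtain ⟨e1, e2, e3⟩ := hk.ae_eq_zero hns hT hL hα hΛL hBL hCL hstab hdet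
    (by rw [hs]; abel) (by rw [hl]; abel)
  filter_upwards [e1, e2, e3, a, b, a₁, b₁, a₂, b₂] with t e1 e2 e3 a b a₁ b₁ a₂ b₂
  rw [← sub_eq_zero, ← norm_eq_zero, ← sq_eq_zero_iff, norm_sq_eq_components]
  have f1 : comp₁ (z t - (z₁ t + z₂ t)) = 0 := by
    rw [← comp₁L_apply, map_sub, map_add, comp₁L_apply, comp₁L_apply, comp₁L_apply, a, a₁, a₂,
      ← e1]
    abel
  have f2 : comp₂ (z t - (z₁ t + z₂ t)) = 0 := by
    rw [← comp₂L_apply, map_sub, map_add, comp₂L_apply, comp₂L_apply, comp₂L_apply, ← e2]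
    abel
  have f3 : comp₃ (z t - (z₁ t + z₂ t)) = 0 := by
    rw [← comp₃L_apply, map_sub, map_add, comp₃L_apply, comp₃L_apply, comp₃L_apply, b, b₁, b₂,
      ← e3]
    abel
  rw [f1, f2, f3]
  simp

/-- Decay of mild solutions whose distributed data are supported in `S`. -/
theorem IsMildSolution.decay_indicator (hns : 0 < ns) (hT : 0 ≤ T) (hL : 1 ≤ L)
    (hα : 0 < α) (hΛL : ‖Λ‖ ≤ L) (hBL : ‖B‖ ≤ L) (hCL : ‖C‖ ≤ L)
    (hstab : IsStabilizable L α Λ B) (hdet : IsDetectable L α Λ C)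
    {p p' z : ℝ → Triple ns nu} {S : Set ℝ} (hS : MeasurableSet S) (hST : S ⊆ Icc 0 T)
    (hp : MemLp p 2 (volume.restrict (Icc 0 T)))
    (hp' : p' =ᵐ[volume.restrict (Icc 0 T)] S.indicator p)
    (hz : MemLp z 2 (volume.restrict (Icc 0 T)))
    (h : IsMildSolution Λ B C T p' 0 0 z) {I : Set ℝ} (hI : MeasurableSet I)
    (hIT : I ⊆ Icc 0 T) :
    l2norm (volume.restrict I) z ≤ 8 * dTilde L α *
      (Real.exp (-setDist I S / (4 * dTilde L α)) * √(∫ t in S, ‖p t‖ ^ 2)) := by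
  have hmp' : MemLp p' 2 (volume.restrict (Icc 0 T)) := (memLp_congr_ae hp').2 (hp.indicator hS)
  have := h.decay hns hT hL hα hΛL hBL hCL hstab hdet hmp' hz hI hIT S
  refine this.trans (le_of_eq ?_)
  rw [norm_zero, mul_zero, mul_zero, add_zero, add_zero]
  congr 2
  have e1 : (fun t => Real.exp (1 / (4 * dTilde L α) * Metric.infDist t S) • p' t)
      =ᵐ[volume.restrict (Icc 0 T)] S.indicator p := by
    filter_upwards [hp'] with t ht
    rw [ht]
    by_cases hts : t ∈ S
    · simp [Metric.infDist_zero_of_mem hts]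
    · simp [hts]
  rw [l2norm_congr e1, l2norm, eLpNorm_indicator_eq_eLpNorm_restrict hS,
    Measure.restrict_restrict hS, inter_eq_left.2 hST,
    sqrt_setIntegral_norm_sq (hp.mono_measure (Measure.restrict_mono hST le_rfl)), l2norm]

end Decay

end LQControl

theorem theorem4p3 {ns nu ny : ℕ} (hns : 0 < ns)
    (Λ : Matrix (Fin ns) (Fin ns) ℝ) (B : Matrix (Fin ns) (Fin nu) ℝ)
    (C : Matrix (Fin ny) (Fin ns) ℝ) (T L α : ℝ) (hT : 0 ≤ T) (hL : 1 ≤ L) (hα : 0 < α)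
    (hΛL : ‖Λ‖ ≤ L) (hBL : ‖B‖ ≤ L) (hCL : ‖C‖ ≤ L)
    (hstab : LQControl.IsStabilizable L α Λ B)
    (hdet : LQControl.IsDetectable L α Λ C)
    (Hinv : LQControl.L2Space ns nu T → LQControl.Vec ns → LQControl.Vec ns →
      LQControl.L2Space ns nu T)
    (hHinv : LQControl.IsBoundedSolutionMap Λ B C T Hinv)
    (I₁ I₂ : Set ℝ) (hI₁ : I₁.OrdConnected) (hI₂ : I₂.OrdConnected)
    (hI₁T : I₁ ⊆ Icc 0 T) (hI₂T : I₂ ⊆ Icc 0 T)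
    (p : LQControl.L2Space ns nu T) (sbar lbar : LQControl.Vec ns) :
    Real.sqrt (∫ t in I₁, ‖Hinv p sbar lbar t‖ ^ 2) ≤
      8 * LQControl.dTilde L α *
        (Real.exp (-LQControl.setDist I₁ {0} / (4 * LQControl.dTilde L α)) * ‖sbar‖
        + Real.exp (-LQControl.setDist I₁ {T} / (4 * LQControl.dTilde L α)) * ‖lbar‖
        + Real.exp (-LQControl.setDist I₁ I₂ / (4 * LQControl.dTilde L α))
          * Real.sqrt (∫ t in I₂, ‖p t‖ ^ 2)
        + Real.exp (-LQControl.setDist I₁ (Icc 0 T \ I₂) / (4 * LQControl.dTilde L α))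
          * Real.sqrt (∫ t in Icc 0 T \ I₂, ‖p t‖ ^ 2)) := by
  have mI₁ : MeasurableSet I₁ := hI₁.measurableSet
  have mI₂ : MeasurableSet I₂ := hI₂.measurableSet
  have mI₂' : MeasurableSet (Icc 0 T \ I₂) := measurableSet_Icc.diff mI₂
  have hp := Lp.memLp p
  have hm := hHinv.mild
  have hz := fun (p : LQControl.L2Space ns nu T) (a b : LQControl.Vec ns) =>
    Lp.memLp (Hinv p a b)
  let pa : LQControl.L2Space ns nu T := (hp.indicator mI₂).toLp _
  let pb : LQControl.L2Space ns nu T := (hp.indicator mI₂').toLp _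
  have hpa : pa =ᵐ[volume.restrict (Icc 0 T)] I₂.indicator p := MemLp.coeFn_toLp _
  have hpb : pb =ᵐ[volume.restrict (Icc 0 T)] (Icc 0 T \ I₂).indicator p := MemLp.coeFn_toLp _
  have h0 : ((0 : LQControl.L2Space ns nu T) : ℝ → LQControl.Triple ns nu)
      =ᵐ[volume.restrict (Icc 0 T)] 0 := Lp.coeFn_zero _ _ _
  have hbdry : ∀ (a b : LQControl.Vec ns) (S : Set ℝ),
      LQControl.l2norm (volume.restrict I₁) (Hinv 0 a b) ≤ 8 * LQControl.dTilde L α *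
        (Real.exp (-LQControl.setDist I₁ S / (4 * LQControl.dTilde L α)) *
        (Real.exp (1 / (4 * LQControl.dTilde L α) * Metric.infDist 0 S) * ‖a‖
          + Real.exp (1 / (4 * LQControl.dTilde L α) * Metric.infDist T S) * ‖b‖)) := by
    intro a b S
    refine ((hm 0 a b).decay hns hT hL hα hΛL hBL hCL hstab hdet (Lp.memLp 0) (hz 0 a b) mI₁
      hI₁T S).trans (le_of_eq ?_)
    have : LQControl.l2norm (volume.restrict (Icc 0 T)) (fun t =>
        Real.exp (1 / (4 * LQControl.dTilde L α) * Metric.infDist t S) •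
          (0 : LQControl.L2Space ns nu T) t) = 0 := by
      rw [LQControl.l2norm_congr (g := fun _ => (0 : LQControl.Triple ns nu)) (by
        filter_upwards [h0] with t ht
        rw [ht]; simp)]
      simp [LQControl.l2norm]
    rw [this, zero_add]
  have b1 := hbdry sbar 0 {0}
  have b2 := hbdry 0 lbar {T}
  simp only [norm_zero, mul_zero, add_zero, zero_add, Metric.infDist_singleton, dist_self,
    Real.exp_zero, one_mul] at b1 b2
  have b3 := (hm pa 0 0).decay_indicator hns hT hL hα hΛL hBL hCL hstab hdet mI₂ hI₂T hp hpa
    (hz pa 0 0) mI₁ hI₁T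
  have b4 := (hm pb 0 0).decay_indicator hns hT hL hα hΛL hBL hCL hstab hdet mI₂' sdiff_subset hp
    hpb (hz pb 0 0) mI₁ hI₁T
  have s1 := (hm p sbar lbar).ae_eq_sum hns hT hL hα hΛL hBL hCL hstab hdet hp (hz _ _ _)
    (Lp.memLp 0) (hz _ _ _) (hm 0 sbar 0) hp (hz _ _ _) (hm p 0 lbar)
    (by filter_upwards [h0] with t ht; rw [ht]; simp) (add_zero _).symm (zero_add _).symm
  have s2 := (hm p 0 lbar).ae_eq_sum hns hT hL hα hΛL hBL hCL hstab hdet hp (hz _ _ _)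
    (Lp.memLp 0) (hz _ _ _) (hm 0 0 lbar) hp (hz _ _ _) (hm p 0 0)
    (by filter_upwards [h0] with t ht; rw [ht]; simp) (add_zero _).symm (add_zero _).symm
  have s3 := (hm p 0 0).ae_eq_sum hns hT hL hα hΛL hBL hCL hstab hdet hp (hz _ _ _)
    (Lp.memLp pa) (hz _ _ _) (hm pa 0 0) (Lp.memLp pb) (hz _ _ _) (hm pb 0 0)
    (by
      filter_upwards [hpa, hpb, ae_restrict_mem measurableSet_Icc] with t ha hb ht
      rw [ha, hb]
      by_cases hti : t ∈ I₂ <;> simp [hti, ht.1, ht.2]) (add_zero _).symm (add_zero _).symm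
  have hle : volume.restrict I₁ ≤ volume.restrict (Icc 0 T) := Measure.restrict_mono hI₁T le_rfl
  have hz₁ := fun (p : LQControl.L2Space ns nu T) (a b : LQControl.Vec ns) =>
    (hz p a b).mono_measure hle
  rw [LQControl.sqrt_setIntegral_norm_sq (hz₁ p sbar lbar)]
  have t1 := (LQControl.l2norm_congr (ae_mono hle s1)).trans_le
    (LQControl.l2norm_add_le (hz₁ 0 sbar 0) (hz₁ p 0 lbar))
  have t2 := (LQControl.l2norm_congr (ae_mono hle s2)).trans_le
    (LQControl.l2norm_add_le (hz₁ 0 0 lbar) (hz₁ p 0 0))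
  have t3 := (LQControl.l2norm_congr (ae_mono hle s3)).trans_le
    (LQControl.l2norm_add_le (hz₁ pa 0 0) (hz₁ pb 0 0))
  linarith
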